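/- Let $N\ge 2$ and $V=\{1,\dots,N\}$. Let $S:\mathbb R\to\mathbb R$ be $C^2$, odd and bounded, with $S(0)=0$, $S'(0)=1$ and $\operatorname{sign}S''(z)=-\operatorname{sign}z$ for all $z$. Let $d,\alpha>0$, and let $\bar A=(\bar a_{ik})\in\{0,1\}^{N\times N}$ be the adjacency matrix of a graph $\bar G$ on $V$ without self-loops ($\bar a_{ik}=1$ iff $(i,k)$ is an edge). Consider $$\dot x_i=-d\,x_i+u\,S\Big(\alpha x_i+\gamma\sum_{k\ne i}\bar a_{ik}x_k\Big),\qquad i=1,\dots,N. \qquad (*)$$ Let $\lambda_{\max}$ and $\lambda_{\min}$ be the greatest and the smallest real part of a (complex) eigenvalue of $\bar A$, and let $W(\lambda)\subseteq\mathbb R^N$ be the generalized eigenspace of $\bar A$ for $\lambda$. We say that equilibria with a property $P$ *emerge at $u_*$ in a steady-state bifurcation off $0$ along $W$* if: $0$ is an equilibrium of $(*)$ for all $u$; the kernel of the Jacobian of $(*)$ at $x=0$, $u=u_*$ is $W\neq\{0\}$; for all $u>u_*$ close to $u_*$ there is an equilibrium $x(u)\ne0$ with property $P$, and $x(u)\to0$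 as $u\searrow u_*$; and, for every $\varepsilon>0$, every equilibrium $x\neq 0$ for a parameter value $u$ with $(u,x)$ close enough to $(u_*,0)$ has property $P$ and satisfies $u>u_*$ and $\operatorname{dist}(x,W)\le\varepsilon\|x\|$. We say that they *form a curve* if, moreover, there is a $C^1$ curve $s\mapsto(u(s),x(s))$, $|s|<s_0$, with $(u(0),x(0))=(u_*,0)$ and $0\ne x'(0)\in W$, such that for $s\neq0$ we have $u(s)>u_*$ and $x(s)\ne0$ is an equilibrium with property $P$ for $u=u(s)$, and such that all pairs $(u,x)$ near $(u_*,0)$ with $x\ne0$ an equilibrium for $u$ lie on the curve. **A (cooperation leads to agreement).** Let $\bar G$ be a strongly connected directed graph and $\gamma>0$, and put $u_a=\dfrac{d}{\alpha+\gamma\lambda_{\max}}$. Then $u_a>0$; the neutral state $x=0$ is a locally exponentially stable equilibrium for $0\le u<u_a$ and an unstable one for $u>u_a$. At $u=u_a$, agreement equilibria (all $x_i$ nonzero and of the same sign) emerge in a steady-state bifurcation off $0$ along $W(\lambda_{\max})$, and they form a curve. **B (competition leads to disagreement).** Let $\bar G$ be a connected undirected graph and $\gamma<0$, and put $u_d=\dfrac{d}{\alpha+\gamma\lambda_{\min}}$.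 Then $u_d>0$; the neutral state $x=0$ is a locally exponentially stable equilibrium for $0\le u<u_d$ and an unstable one for $u>u_d$. At $u=u_d$, disagreement equilibria ($x_i>0>x_k$ for some $i,k$) emerge in a steady-state bifurcation off $0$ along $W(\lambda_{\min})$; if $\dim W(\lambda_{\min})=1$, they form a curve. -/

import Mathlib

open Filter Topology

noncomputable section

/-- An odd saturating function: odd, bounded, of class `C²`, with `S 0 = 0`, `S' 0 = 1` and
`sign (S'' z) = - sign z`. -/
structure IsSaturating (S : ℝ → ℝ) : Prop where
  contDiff : ContDiff ℝ 2 S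
  odd : ∀ z, S (-z) = -S z
  bounded : ∃ B : ℝ, ∀ z, |S z| ≤ B
  map_zero : S 0 = 0
  deriv_zero : deriv S 0 = 1
  sign_deriv2 : ∀ z, SignType.sign (deriv (deriv S) z) = -SignType.sign z

section Graph

variable {V : Type*}

/-- Strong connectedness: there is a directed path between any two vertices. -/
def Digraph.StronglyConnected (G : Digraph V) : Prop :=
  ∀ i k, Relation.ReflTransGen G.Adj i k

open Classical in
/-- The unweighted adjacency matrix of a digraph (entry `1` at `(i, k)` iff `(i, k)` is an edge,
that is, iff `k` is a neighbor of `i`). -/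
def Digraph.adjacency (G : Digraph V) : Matrix V V ℝ :=
  Matrix.of fun i k => if G.Adj i k then 1 else 0

variable [Fintype V] [DecidableEq V]

/-- The real parts of the complex eigenvalues of a real square matrix. -/
def eigenRealParts (A : Matrix V V ℝ) : Set ℝ :=
  Complex.re '' spectrum ℂ (A.map (algebraMap ℝ ℂ))

/-- The greatest real part of an eigenvalue. -/
def lambdaMax (A : Matrix V V ℝ) : ℝ := sSup (eigenRealParts A)

/-- The smallest real part of an eigenvalue. -/
def lambdaMin (A : Matrix V V ℝ) : ℝ := sInf (eigenRealParts A)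

/-- The generalized eigenspace `W(l)` of the matrix `A`. -/
def genEigenspace (A : Matrix V V ℝ) (l : ℝ) : Submodule ℝ (V → ℝ) :=
  Module.End.maxGenEigenspace (Matrix.toLin' A) l

/-- The right-hand side of the homogeneous unbiased opinion dynamics
`xᵢ' = -d xᵢ + u S(α xᵢ + γ ∑ₖ Aᵢₖ xₖ)` (the matrix `A` is used with zero diagonal only, so the sum
over all `k` is the sum over `k ≠ i`). -/
def opinionField (S : ℝ → ℝ) (d α γ : ℝ) (A : Matrix V V ℝ) (u : ℝ) (x : V → ℝ) : V → ℝ :=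
  fun i => -d * x i + u * S (α * x i + γ * ∑ k, A i k * x k)

/-- All opinions are nonzero and have the same sign. -/
def IsAgreement (x : V → ℝ) : Prop := (∀ i, 0 < x i) ∨ (∀ i, x i < 0)

/-- At least two agents have nonzero opinions of opposite signs. -/
def IsDisagreement (x : V → ℝ) : Prop := ∃ i k, 0 < x i ∧ x k < 0

end Graph

section Dynamics

variable {E : Type*} [NormedAddCommGroup E] [NormedSpace ℝ E]

/-- `0` is a locally exponentially stable equilibrium of `x' = f x`. Solutions are taken on
arbitrary intervals `[0, T]`, so that nothing depends on global existence. -/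
def IsLocallyExpStable (f : E → E) : Prop :=
  f 0 = 0 ∧ ∃ δ > 0, ∃ C > 0, ∃ c > 0, ∀ T > 0, ∀ x : ℝ → E,
    IsIntegralCurveOn x (fun _ => f) (Set.Icc 0 T) → ‖x 0‖ < δ →
      ∀ t ∈ Set.Icc 0 T, ‖x t‖ ≤ C * Real.exp (-c * t) * ‖x 0‖

/-- `0` is a Lyapunov stable equilibrium of `x' = f x`. -/
def IsLyapunovStable (f : E → E) : Prop :=
  f 0 = 0 ∧ ∀ ε > 0, ∃ δ > 0, ∀ T > 0, ∀ x : ℝ → E,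
    IsIntegralCurveOn x (fun _ => f) (Set.Icc 0 T) → ‖x 0‖ < δ →
      ∀ t ∈ Set.Icc 0 T, ‖x t‖ < ε

/-- `0` is an unstable equilibrium of `x' = f x`. -/
def IsUnstable (f : E → E) : Prop := f 0 = 0 ∧ ¬ IsLyapunovStable f

/-- At the parameter value `u₀`, equilibria of `x' = F u x` with property `P` emerge (for `u > u₀`)
in a steady-state bifurcation off the equilibrium `0` along the subspace `W`. -/
structure BifurcatesAlong (F : ℝ → E → E) (u₀ : ℝ) (W : Submodule ℝ E) (P : E → Prop) :
    Prop where
  /-- `0` is an equilibrium for all parameter values. -/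
  trivial_branch : ∀ u, F u 0 = 0
  /-- The linearization at the bifurcation point is singular, with kernel `W`. -/
  ne_bot : W ≠ ⊥
  differentiable : DifferentiableAt ℝ (F u₀) 0
  kernel : ∀ v, fderiv ℝ (F u₀) 0 v = 0 ↔ v ∈ W
  /-- A family of nonzero equilibria with property `P` that exists for all `u > u₀` close to `u₀`
  emanates from `0`. -/
  emerge : ∃ x : ℝ → E, (∀ᶠ u in 𝓝[>] u₀, x u ≠ 0 ∧ F u (x u) = 0 ∧ P (x u)) ∧
    Tendsto x (𝓝[>] u₀) (𝓝 0)
  /-- All nonzero equilibria close to the bifurcation point occur for `u > u₀`, have property `P`,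
  and are tangent to `W`. -/
  nearby : ∀ ε > 0, ∀ᶠ p : ℝ × E in 𝓝 (u₀, 0), F p.1 p.2 = 0 → p.2 ≠ 0 →
    u₀ < p.1 ∧ P p.2 ∧ Metric.infDist p.2 (W : Set E) ≤ ε * ‖p.2‖

/-- Near `(u₀, 0)` the nonzero equilibria of `x' = F u x` form a `C¹` curve
`s ↦ (υ s, ξ s)`, `s ≠ 0`, through `(u₀, 0)`, whose state component is tangent at `s = 0` to a
nonzero vector of `W`; along it `u > u₀`, and the equilibria have property `P`. -/
def HasBifurcationCurve (F : ℝ → E → E) (u₀ : ℝ) (W : Submodule ℝ E) (P : E → Prop) : Prop :=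
  ∃ ε > 0, ∃ (ξ : ℝ → E) (υ : ℝ → ℝ), ∃ v ∈ W, v ≠ 0 ∧
    ContDiffOn ℝ 1 ξ (Set.Ioo (-ε) ε) ∧ ContDiffOn ℝ 1 υ (Set.Ioo (-ε) ε) ∧
    ξ 0 = 0 ∧ υ 0 = u₀ ∧ HasDerivAt ξ v 0 ∧
    (∀ s ∈ Set.Ioo (-ε) ε, s ≠ 0 →
      u₀ < υ s ∧ ξ s ≠ 0 ∧ F (υ s) (ξ s) = 0 ∧ P (ξ s)) ∧
    (∀ᶠ p : ℝ × E in 𝓝 (u₀, 0), F p.1 p.2 = 0 → p.2 ≠ 0 →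
      ∃ s ∈ Set.Ioo (-ε) ε, p = (υ s, ξ s))

end Dynamics

end

/-! Both parts are instances of one statement about `x' = -d x + u S(M x)` with `M = α + γ A`. All
that is needed of `M` is a positive eigenvalue `μ` and positive weights `q` such that `⟨x, M x⟩ ≤ μ
⟨x, x⟩` for the inner product weighted by `q` (`IsDominantEigenvalue`). For an undirected graph `q =
1` and this is the Rayleigh bound; negative `γ` turns the least eigenvalue of `A` into the greatest
of `M`. For a strongly connected digraph `q = p / w` works, with `w`, `p` the right and left Perron
vectors (`wdot_mulVec_le_of_perron`).

The inequality forces eigenvectors for `μ` to be adjoint eigenvectors, so `μ` has no Jordan block,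
and it bounds the real part of every complex eigenvalue. The weighted square norm is a Lyapunov
function for `u < d / μ`; for `u > d / μ` a solution started near `0` on an eigenvector escapes.

Bifurcating equilibria lie at `u > d / μ` by a global argument, with no third derivative: if `d x =
u s` with `s = S(M x)`, then `⟨s, s⟩ < ⟨s, M x⟩ = (u / d) ⟨s, M s⟩ ≤ (u μ / d) ⟨s, s⟩`
(`lt_of_equilibrium`). Dividing the equation by the amplitude and applying the inverse function
theorem gives the curve when the eigenvalue is simple (`hasBifurcationCurve`). When it is multiple,
symmetry of `M` gives equilibria as minimizers of an energy
(`eventually_exists_equilibrium_of_symmetric`). Agreement holds because small equilibria are nearly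
parallel to the positive Perron vector; disagreement because competing agents whose opinions share a
sign cannot sustain them when `u α < d`. -/

noncomputable section

/-! ### Saturating functions: monotonicity, contraction, flatness at the origin. -/

namespace IsSaturating

variable {S : ℝ → ℝ}

lemma differentiable (hS : IsSaturating S) : Differentiable ℝ S :=
  hS.contDiff.differentiable (by norm_num)

lemma continuous (hS : IsSaturating S) : Continuous S := hS.contDiff.continuous

lemma hasDerivAt (hS : IsSaturating S) (z : ℝ) : HasDerivAt S (deriv S z) z :=
  (hS.differentiable z).hasDerivAt

lemma contDiff_deriv (hS : IsSaturating S) : ContDiff ℝ 1 (deriv S) := by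
  have h : ContDiff ℝ (1 + 1) S := by simpa [one_add_one_eq_two] using hS.contDiff
  exact (contDiff_succ_iff_deriv.1 h).2.2

lemma continuous_deriv (hS : IsSaturating S) : Continuous (deriv S) :=
  hS.contDiff_deriv.continuous

lemma hasDerivAt_deriv (hS : IsSaturating S) (z : ℝ) :
    HasDerivAt (deriv S) (deriv (deriv S) z) z :=
  (hS.contDiff_deriv.differentiable (by norm_num) z).hasDerivAt

lemma continuous_deriv2 (hS : IsSaturating S) : Continuous (deriv (deriv S)) :=
  hS.contDiff_deriv.continuous_deriv le_rfl

lemma deriv2_neg (hS : IsSaturating S) {z : ℝ} (hz : 0 < z) : deriv (deriv S) z < 0 := by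
  have h := hS.sign_deriv2 z
  rw [sign_pos hz] at h
  exact sign_eq_neg_one_iff.1 h

lemma deriv2_zero (hS : IsSaturating S) : deriv (deriv S) 0 = 0 := by
  have h := hS.sign_deriv2 0
  rw [sign_zero, neg_zero] at h
  exact sign_eq_zero_iff.1 h

lemma deriv_neg (hS : IsSaturating S) (z : ℝ) : deriv S (-z) = deriv S z := by
  have h1 : HasDerivAt (fun x => S (-x)) (-deriv S (-z)) z := by
    have h := (hS.hasDerivAt (-z)).scomp z (hasDerivAt_neg z)
    rwa [neg_one_smul] at h
  have h2 : HasDerivAt (fun x => S (-x)) (-deriv S z) z := by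
    simp_rw [hS.odd]
    exact (hS.hasDerivAt z).neg
  linarith [h1.unique h2]

lemma strictAntiOn_deriv (hS : IsSaturating S) : StrictAntiOn (deriv S) (Set.Ici 0) := by
  apply strictAntiOn_of_deriv_neg (convex_Ici 0) hS.continuous_deriv.continuousOn
  intro z hz
  rw [interior_Ici] at hz
  exact hS.deriv2_neg hz

lemma deriv_lt_one (hS : IsSaturating S) {z : ℝ} (hz : 0 < z) : deriv S z < 1 := by
  have := hS.strictAntiOn_deriv (Set.mem_Ici.2 le_rfl) (Set.mem_Ici.2 hz.le) hz
  rwa [hS.deriv_zero] at this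

/-- If `S'` were nonpositive at `z`, it would be negative and decreasing from `z + 1` on, so `S`
would fall at least linearly and be unbounded. -/
lemma deriv_pos_of_pos (hS : IsSaturating S) {z : ℝ} (hz : 0 < z) : 0 < deriv S z := by
  by_contra! hneg
  have hm : deriv S (z + 1) < 0 :=
    (hS.strictAntiOn_deriv (Set.mem_Ici.2 hz.le) (Set.mem_Ici.2 (by linarith))
      (by linarith)).trans_le hneg
  set m := deriv S (z + 1)
  obtain ⟨B, hB⟩ := hS.bounded
  have hB0 : 0 ≤ B := (abs_nonneg _).trans (hB 0)
  have key : ∀ y, z + 1 ≤ y → S y - S (z + 1) ≤ m * (y - (z + 1)) := by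
    intro y hy
    apply Convex.image_sub_le_mul_sub_of_deriv_le (convex_Ici (z + 1))
      hS.continuous.continuousOn hS.differentiable.differentiableOn _ _
      (Set.mem_Ici.2 le_rfl) _ (Set.mem_Ici.2 hy) hy
    intro x hx
    rw [interior_Ici] at hx
    have hx' : z + 1 < x := hx
    exact (hS.strictAntiOn_deriv (Set.mem_Ici.2 (by linarith)) (Set.mem_Ici.2 (by linarith))
      hx').le
  -- At this point the linear bound has dropped by `2 * B + 1`, more than the range `2 * B` allows.
  have h1 := key (z + 1 + (2 * B + 1) / (-m)) (by
    have : 0 < (2 * B + 1) / (-m) := div_pos (by linarith) (by linarith)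
    linarith)
  have h2 : m * (z + 1 + (2 * B + 1) / (-m) - (z + 1)) = -(2 * B + 1) := by
    have : m ≠ 0 := hm.ne
    field_simp
    ring
  rw [h2] at h1
  have h3 := abs_le.1 (hB (z + 1))
  have h4 := abs_le.1 (hB (z + 1 + (2 * B + 1) / (-m)))
  linarith [h3.2, h4.1]

lemma deriv_pos (hS : IsSaturating S) (z : ℝ) : 0 < deriv S z := by
  rcases lt_trichotomy z 0 with h | h | h
  · rw [← hS.deriv_neg]
    exact hS.deriv_pos_of_pos (by linarith)
  · rw [h, hS.deriv_zero]
    exact one_pos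
  · exact hS.deriv_pos_of_pos h

lemma deriv_le_one (hS : IsSaturating S) (z : ℝ) : deriv S z ≤ 1 := by
  rcases lt_trichotomy z 0 with h | h | h
  · rw [← hS.deriv_neg]
    exact (hS.deriv_lt_one (by linarith)).le
  · rw [h, hS.deriv_zero]
  · exact (hS.deriv_lt_one h).le

lemma strictMono (hS : IsSaturating S) : StrictMono S :=
  strictMono_of_deriv_pos hS.deriv_pos

lemma pos_iff (hS : IsSaturating S) {z : ℝ} : 0 < S z ↔ 0 < z := by
  simpa [hS.map_zero] using hS.strictMono.lt_iff_lt (a := 0) (b := z)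

lemma eq_zero_iff (hS : IsSaturating S) {z : ℝ} : S z = 0 ↔ z = 0 := by
  simpa [hS.map_zero] using hS.strictMono.injective.eq_iff (a := z) (b := 0)

lemma lipschitz (hS : IsSaturating S) : LipschitzWith 1 S :=
  lipschitzWith_of_nnnorm_deriv_le hS.differentiable fun z => by
    rw [← NNReal.coe_le_coe, coe_nnnorm, Real.norm_eq_abs, abs_of_pos (hS.deriv_pos z)]
    exact hS.deriv_le_one z

lemma abs_le_abs (hS : IsSaturating S) (z : ℝ) : |S z| ≤ |z| := by
  simpa [hS.map_zero, Real.dist_eq] using hS.lipschitz.dist_le_mul z 0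

lemma lt_self (hS : IsSaturating S) {z : ℝ} (hz : 0 < z) : S z < z := by
  have h : StrictMonoOn (fun z => z - S z) (Set.Ici 0) := by
    apply strictMonoOn_of_deriv_pos (convex_Ici 0)
      (show Continuous fun z => z - S z from continuous_id.sub hS.continuous).continuousOn
    intro y hy
    rw [interior_Ici] at hy
    have hd : HasDerivAt (fun z => z - S z) (1 - deriv S y) y :=
      (hasDerivAt_id' y).sub (hS.hasDerivAt y)
    rw [hd.deriv]
    linarith [hS.deriv_lt_one hy]
  have := h (Set.mem_Ici.2 le_rfl) (Set.mem_Ici.2 hz.le) hz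
  simp only [hS.map_zero] at this
  linarith

lemma sq_le_mul (hS : IsSaturating S) (z : ℝ) : S z * S z ≤ S z * z := by
  rcases lt_trichotomy z 0 with h | h | h
  · have h1 := hS.lt_self (z := -z) (by linarith)
    have h2 := hS.pos_iff.2 (show 0 < -z by linarith)
    rw [hS.odd] at h1 h2
    nlinarith
  · simp [h, hS.map_zero]
  · nlinarith [hS.lt_self h, hS.pos_iff.2 h]

lemma sq_lt_mul (hS : IsSaturating S) {z : ℝ} (hz : z ≠ 0) : S z * S z < S z * z := by
  rcases lt_or_gt_of_ne hz with h | h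
  · have h1 := hS.lt_self (z := -z) (by linarith)
    have h2 := hS.pos_iff.2 (show 0 < -z by linarith)
    rw [hS.odd] at h1 h2
    nlinarith
  · nlinarith [hS.lt_self h, hS.pos_iff.2 h]

/-- The remainder `S z - z` is `o(z²)`. -/
lemma tendsto_sub_div_sq (hS : IsSaturating S) :
    Tendsto (fun z => (S z - z) / z ^ 2) (𝓝[≠] 0) (𝓝 0) := by
  have hne : ∀ᶠ z : ℝ in 𝓝[≠] 0, z ≠ 0 := eventually_mem_nhdsWithin
  have hcont : ∀ f : ℝ → ℝ, Continuous f → f 0 = 0 → Tendsto f (𝓝[≠] 0) (𝓝 0) := by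
    intro f hf h0
    have := hf.tendsto 0
    rw [h0] at this
    exact this.mono_left nhdsWithin_le_nhds
  -- L'Hôpital twice: the limit is `S'' 0 / 2`, and `S'' 0 = 0` by the sign condition.
  refine HasDerivAt.lhopital_zero_nhdsNE (f' := fun z => deriv S z - 1) (g' := fun z => 2 * z)
    ?_ ?_ ?_ ?_ ?_ ?_
  · exact Eventually.of_forall fun z => (hS.hasDerivAt z).sub (hasDerivAt_id' z)
  · exact Eventually.of_forall fun z => by simpa using hasDerivAt_pow 2 z
  · filter_upwards [hne] with z hz
    simpa using hz
  · exact hcont _ (hS.continuous.sub continuous_id) (by simp [hS.map_zero])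
  · exact hcont _ (by fun_prop) (by simp)
  refine HasDerivAt.lhopital_zero_nhdsNE (f' := fun z => deriv (deriv S) z) (g' := fun _ => 2)
    ?_ ?_ ?_ ?_ ?_ ?_
  · exact Eventually.of_forall fun z => (hS.hasDerivAt_deriv z).sub_const 1
  · exact Eventually.of_forall fun z => by simpa using (hasDerivAt_id' z).const_mul 2
  · exact Eventually.of_forall fun z => two_ne_zero
  · exact hcont _ (hS.continuous_deriv.sub continuous_const) (by simp [hS.deriv_zero])
  · exact hcont _ (by fun_prop) (by simp)
  · exact hcont _ (hS.continuous_deriv2.div_const 2) (by simp [hS.deriv2_zero])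

/-- Near `0` this is the `o(z²)` estimate; for `|z| ≥ r` it follows from `|S z - z| ≤ |z| ≤ z² / r`.
Being global, it needs no smallness conditions later. -/
lemma exists_abs_sub_le_sq (hS : IsSaturating S) : ∃ C > 0, ∀ z, |S z - z| ≤ C * z ^ 2 := by
  have h := hS.tendsto_sub_div_sq.eventually (Metric.ball_mem_nhds (0 : ℝ) one_pos)
  rw [eventually_nhdsWithin_iff, Metric.eventually_nhds_iff] at h
  obtain ⟨r, hr, h⟩ := h
  refine ⟨max 1 (1 / r), by positivity, fun z => ?_⟩
  by_cases hz : z = 0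
  · simp [hz, hS.map_zero]
  by_cases hzr : |z| < r
  · have h1 := h (y := z) (by simpa [Real.dist_eq] using hzr) hz
    rw [dist_zero_right, Real.norm_eq_abs, abs_div, abs_of_nonneg (sq_nonneg z),
      div_lt_one (by positivity)] at h1
    calc |S z - z| ≤ 1 * z ^ 2 := by linarith
      _ ≤ max 1 (1 / r) * z ^ 2 := by gcongr; exact le_max_left _ _
  · push Not at hzr
    have h2 : |S z - z| ≤ |z| := by
      have h4 := hS.sq_le_mul z
      have h3 : (S z - z) ^ 2 ≤ z ^ 2 := by nlinarith [sq_nonneg (S z)]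
      exact sq_le_sq.1 h3
    calc |S z - z| ≤ |z| := h2
      _ = 1 / r * (r * |z|) := by field_simp
      _ ≤ 1 / r * (|z| * |z|) := by gcongr
      _ = 1 / r * z ^ 2 := by rw [abs_mul_abs_self]; ring
      _ ≤ max 1 (1 / r) * z ^ 2 := by gcongr; exact le_max_right _ _

end IsSaturating

/-! ### The gain `S z / z` as a `C¹` function. -/

/-- The quotient `S z / z`, extended by `1` at `0`. -/
def gain (S : ℝ → ℝ) (z : ℝ) : ℝ := if z = 0 then 1 else S z / z

lemma gain_zero (S : ℝ → ℝ) : gain S 0 = 1 := if_pos rfl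

lemma IsSaturating.mul_gain {S : ℝ → ℝ} (hS : IsSaturating S) (z : ℝ) : z * gain S z = S z := by
  unfold gain
  split_ifs with h
  · simp [h, hS.map_zero]
  · field_simp

lemma IsSaturating.hasDerivAt_gain_zero {S : ℝ → ℝ} (hS : IsSaturating S) :
    HasDerivAt (gain S) 0 0 := by
  rw [hasDerivAt_iff_tendsto_slope]
  refine hS.tendsto_sub_div_sq.congr' ?_
  filter_upwards [eventually_mem_nhdsWithin] with z hz
  have hz : z ≠ 0 := hz
  rw [slope_def_field, gain_zero, gain, if_neg hz]
  field_simp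
  ring

lemma IsSaturating.hasDerivAt_gain {S : ℝ → ℝ} (hS : IsSaturating S) {z : ℝ} (hz : z ≠ 0) :
    HasDerivAt (gain S) ((deriv S z * z - S z) / z ^ 2) z := by
  have h : HasDerivAt (fun y => S y / y) ((deriv S z * z - S z * 1) / z ^ 2) z :=
    (hS.hasDerivAt z).div (hasDerivAt_id' z) hz
  rw [mul_one] at h
  refine h.congr_of_eventuallyEq ?_
  filter_upwards [isOpen_ne.mem_nhds hz] with y hy
  exact if_neg hy

/-- Away from `0` the derivative is `(S' z - 1) / z - (S z - z) / z²`, and both terms tend to `0`.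
This regularity lets the inverse function theorem act on the equation divided by the amplitude,
although `S` is only `C²`. -/
lemma IsSaturating.contDiff_gain {S : ℝ → ℝ} (hS : IsSaturating S) : ContDiff ℝ 1 (gain S) := by
  rw [contDiff_one_iff_deriv]
  have hd : Differentiable ℝ (gain S) := fun z => by
    by_cases hz : z = 0
    · rw [hz]; exact hS.hasDerivAt_gain_zero.differentiableAt
    · exact (hS.hasDerivAt_gain hz).differentiableAt
  refine ⟨hd, continuous_iff_continuousAt.2 fun z => ?_⟩
  by_cases hz : z = 0
  · subst hz
    rw [continuousAt_iff_punctured_nhds, hS.hasDerivAt_gain_zero.deriv]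
    have h1 : Tendsto (fun z => (deriv S z - 1) / z) (𝓝[≠] 0) (𝓝 0) := by
      have := hasDerivAt_iff_tendsto_slope.1 (hS.hasDerivAt_deriv 0)
      rw [hS.deriv2_zero] at this
      refine this.congr fun z => ?_
      rw [slope_def_field, hS.deriv_zero, sub_zero]
    have h2 := h1.sub hS.tendsto_sub_div_sq
    rw [sub_zero] at h2
    refine h2.congr' ?_
    filter_upwards [eventually_mem_nhdsWithin] with z hz
    have hz : z ≠ 0 := hz
    rw [(hS.hasDerivAt_gain hz).deriv]
    field_simp
    ring
  · have hc : ContinuousAt (fun z => (deriv S z * z - S z) / z ^ 2) z :=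
      ((hS.continuous_deriv.mul continuous_id).sub hS.continuous).continuousAt.div
        (by fun_prop) (by positivity)
    refine hc.congr ?_
    filter_upwards [isOpen_ne.mem_nhds hz] with y hy
    exact (hS.hasDerivAt_gain hy).deriv.symm

lemma eq_zero_of_forall_mul_le_sq_mul {a b : ℝ} (h : ∀ t : ℝ, t * a ≤ t ^ 2 * b) : a = 0 := by
  have hb : 0 ≤ b := by linarith [h 1, h (-1)]
  by_contra ha
  -- At this `t` the inequality reads `a² / (b + 1) ≤ a² / (b + 1) * (b / (b + 1))`; the `+ 1`
  -- covers `b = 0`.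
  have h1 := h (a / (b + 1))
  have h2 : a / (b + 1) * a = a ^ 2 / (b + 1) := by ring
  have h3 : (a / (b + 1)) ^ 2 * b = a ^ 2 / (b + 1) * (b / (b + 1)) := by
    field_simp
  rw [h2, h3] at h1
  have h4 : 0 < a ^ 2 / (b + 1) := by positivity
  have h5 : b / (b + 1) < 1 := by rw [div_lt_one (by linarith)]; linarith
  nlinarith

/-! ### Weighted inner products and dominant eigenvalues. -/

section WeightedForm

variable {V : Type*} [Fintype V]

/-- The diagonal bilinear form with weights `q`. -/
def wdot (q x y : V → ℝ) : ℝ := ∑ i, q i * (x i * y i)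

lemma wdot_comm (q x y : V → ℝ) : wdot q x y = wdot q y x := by
  simp only [wdot, mul_comm]

lemma wdot_add_left (q x y z : V → ℝ) : wdot q (x + y) z = wdot q x z + wdot q y z := by
  simp only [wdot, Pi.add_apply, ← Finset.sum_add_distrib]
  exact Finset.sum_congr rfl fun i _ => by ring

lemma wdot_smul_left (q : V → ℝ) (c : ℝ) (x y : V → ℝ) :
    wdot q (c • x) y = c * wdot q x y := by
  simp only [wdot, Pi.smul_apply, smul_eq_mul, Finset.mul_sum]
  exact Finset.sum_congr rfl fun i _ => by ring

lemma wdot_add_right (q x y z : V → ℝ) : wdot q x (y + z) = wdot q x y + wdot q x z := by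
  rw [wdot_comm, wdot_add_left, wdot_comm q y, wdot_comm q z]

lemma wdot_smul_right (q : V → ℝ) (c : ℝ) (x y : V → ℝ) :
    wdot q x (c • y) = c * wdot q x y := by
  rw [wdot_comm, wdot_smul_left, wdot_comm]

lemma wdot_sub_left (q x y z : V → ℝ) : wdot q (x - y) z = wdot q x z - wdot q y z := by
  rw [sub_eq_add_neg, wdot_add_left, ← neg_one_smul ℝ, wdot_smul_left]
  ring

lemma wdot_sub_right (q x y z : V → ℝ) : wdot q x (y - z) = wdot q x y - wdot q x z := by
  rw [wdot_comm, wdot_sub_left, wdot_comm q y, wdot_comm q z]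

lemma wdot_zero_right (q x : V → ℝ) : wdot q x 0 = 0 := by simp [wdot]

variable {q : V → ℝ}

lemma wdot_self_nonneg (hq : ∀ i, 0 < q i) (x : V → ℝ) : 0 ≤ wdot q x x :=
  Finset.sum_nonneg fun i _ => mul_nonneg (hq i).le (mul_self_nonneg _)

lemma wdot_self_eq_zero (hq : ∀ i, 0 < q i) {x : V → ℝ} : wdot q x x = 0 ↔ x = 0 := by
  refine ⟨fun h => ?_, fun h => by simp [h, wdot]⟩
  rw [wdot, Finset.sum_eq_zero_iff_of_nonneg
    fun i _ => mul_nonneg (hq i).le (mul_self_nonneg _)] at h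
  funext i
  simpa [(hq i).ne'] using h i (Finset.mem_univ i)

lemma wdot_self_pos (hq : ∀ i, 0 < q i) {x : V → ℝ} (hx : x ≠ 0) : 0 < wdot q x x :=
  (wdot_self_nonneg hq x).lt_of_ne fun h => hx ((wdot_self_eq_zero hq).1 h.symm)

lemma wdot_sq_le (hq : ∀ i, 0 < q i) (x y : V → ℝ) :
    wdot q x y ^ 2 ≤ wdot q x x * wdot q y y :=
  Finset.sum_sq_le_sum_mul_sum_of_sq_le_mul _
    (fun i _ => mul_nonneg (hq i).le (mul_self_nonneg _))
    (fun i _ => mul_nonneg (hq i).le (mul_self_nonneg _)) fun i _ => le_of_eq (by ring)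

lemma wdot_add_self_le (hq : ∀ i, 0 < q i) (x y : V → ℝ) :
    wdot q (x + y) (x + y) ≤ 2 * (wdot q x x + wdot q y y) := by
  have h := wdot_self_nonneg hq (x - y)
  simp only [wdot_sub_left, wdot_sub_right, wdot_add_left, wdot_add_right] at h ⊢
  linarith

lemma exists_wdot_self_le (hq : ∀ i, 0 < q i) :
    ∃ b > 0, ∀ x : V → ℝ, wdot q x x ≤ b * ‖x‖ ^ 2 := by
  have h0 : 0 ≤ ∑ i, q i := Finset.sum_nonneg fun i _ => (hq i).le
  refine ⟨∑ i, q i + 1, by linarith, fun x => ?_⟩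
  have : wdot q x x ≤ (∑ i, q i) * ‖x‖ ^ 2 := by
    rw [wdot, Finset.sum_mul]
    refine Finset.sum_le_sum fun i _ => mul_le_mul_of_nonneg_left ?_ (hq i).le
    have h := norm_le_pi_norm x i
    rw [Real.norm_eq_abs] at h
    rw [← abs_mul_abs_self, sq]
    exact mul_self_le_mul_self (abs_nonneg _) h
  nlinarith [sq_nonneg ‖x‖]

lemma exists_norm_sq_le_wdot_self (hq : ∀ i, 0 < q i) :
    ∃ a > 0, ∀ x : V → ℝ, ‖x‖ ^ 2 ≤ a * wdot q x x := by
  refine ⟨∑ i, (q i)⁻¹ + 1, ?_, fun x => ?_⟩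
  · have h0 : 0 ≤ ∑ i, (q i)⁻¹ := Finset.sum_nonneg fun i _ => (inv_pos.2 (hq i)).le
    linarith
  have ha : ∀ i, (q i)⁻¹ ≤ ∑ i, (q i)⁻¹ + 1 := fun i => by
    have := Finset.single_le_sum (f := fun i => (q i)⁻¹) (fun i _ => (inv_pos.2 (hq i)).le)
      (Finset.mem_univ i)
    linarith
  have h0 : 0 ≤ (∑ i, (q i)⁻¹ + 1) * wdot q x x :=
    mul_nonneg (by have := Finset.sum_nonneg fun i (_ : i ∈ Finset.univ) =>
      (inv_pos.2 (hq i)).le; linarith) (wdot_self_nonneg hq x)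
  rw [← Real.le_sqrt (norm_nonneg _) h0, pi_norm_le_iff_of_nonneg (Real.sqrt_nonneg _)]
  intro i
  rw [Real.le_sqrt (norm_nonneg _) h0, Real.norm_eq_abs, sq_abs]
  have h1 : q i * (x i * x i) ≤ wdot q x x :=
    Finset.single_le_sum (f := fun i => q i * (x i * x i))
      (fun i _ => mul_nonneg (hq i).le (mul_self_nonneg _)) (Finset.mem_univ i)
  calc x i ^ 2 = (q i)⁻¹ * (q i * (x i * x i)) := by field_simp [(hq i).ne']
    _ ≤ (q i)⁻¹ * wdot q x x := mul_le_mul_of_nonneg_left h1 (inv_pos.2 (hq i)).le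
    _ ≤ _ := mul_le_mul_of_nonneg_right (ha i) (wdot_self_nonneg hq x)

lemma HasDerivWithinAt.wdot_self {x : ℝ → V → ℝ} {x' : V → ℝ} {s : Set ℝ} {t : ℝ}
    (h : HasDerivWithinAt x x' s t) :
    HasDerivWithinAt (fun t => wdot q (x t) (x t)) (2 * wdot q (x t) x') s t := by
  rw [hasDerivWithinAt_pi] at h
  have := HasDerivWithinAt.fun_sum (u := Finset.univ)
    fun i _ => (((h i).mul (h i)).const_mul (q i))
  refine this.congr_deriv ?_
  rw [wdot, Finset.mul_sum]
  exact Finset.sum_congr rfl fun i _ => by ring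

lemma exists_norm_mulVec_le [DecidableEq V] (M : Matrix V V ℝ) :
    ∃ L > 0, ∀ x, ‖M.mulVec x‖ ≤ L * ‖x‖ := by
  obtain ⟨L, hL, h⟩ := (LinearMap.toContinuousLinearMap (Matrix.toLin' M)).bound
  exact ⟨L, hL, fun x => by simpa using h x⟩

/-- `μ > 0` is an eigenvalue of `M`, and `M - μ` is dissipative for the weights `q`. -/
structure IsDominantEigenvalue (M : Matrix V V ℝ) (q : V → ℝ) (μ : ℝ) : Prop where
  weight_pos : ∀ i, 0 < q i
  pos : 0 < μ
  wdot_mulVec_le : ∀ x, wdot q x (M.mulVec x) ≤ μ * wdot q x x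
  exists_eigenvector : ∃ w, w ≠ 0 ∧ M.mulVec w = μ • w

namespace IsDominantEigenvalue

variable {M : Matrix V V ℝ} {μ : ℝ}

/-- An eigenvector for the dominant eigenvalue is also an eigenvector of the adjoint. -/
lemma wdot_eigenvector_mulVec (h : IsDominantEigenvalue M q μ) {z : V → ℝ}
    (hz : M.mulVec z = μ • z) (x : V → ℝ) : wdot q z (M.mulVec x) = μ * wdot q z x := by
  -- The dissipation inequality is an equality at `z`, so along `z + t • x` its defect is a
  -- nonnegative quadratic in `t` without constant term; the linear coefficient must vanish.
  have key : ∀ t : ℝ, t * (wdot q z (M.mulVec x) - μ * wdot q z x) ≤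
      t ^ 2 * (μ * wdot q x x - wdot q x (M.mulVec x)) := by
    intro t
    have := h.wdot_mulVec_le (z + t • x)
    simp only [Matrix.mulVec_add, Matrix.mulVec_smul, hz, wdot_add_left, wdot_add_right,
      wdot_smul_left, wdot_smul_right, wdot_comm q x z] at this
    nlinarith
  linarith [eq_zero_of_forall_mul_le_sq_mul key]

/-- With `z = M x - μ x` an eigenvector, hence also an adjoint one, `⟨z, z⟩ = ⟨z, M x⟩ - μ ⟨z, x⟩ =
0`. This excludes Jordan blocks. -/
lemma eq_zero_of_sub_smul (h : IsDominantEigenvalue M q μ) {x : V → ℝ}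
    (hz : M.mulVec (M.mulVec x - μ • x) = μ • (M.mulVec x - μ • x)) :
    M.mulVec x - μ • x = 0 := by
  rw [← wdot_self_eq_zero h.weight_pos, wdot_sub_right, h.wdot_eigenvector_mulVec hz, wdot_smul_right, sub_self]

end IsDominantEigenvalue

lemma mulVec_affine_eq_iff [DecidableEq V] {A : Matrix V V ℝ} {α γ l : ℝ} (hγ : γ ≠ 0)
    {x : V → ℝ} :
    (α • (1 : Matrix V V ℝ) + γ • A).mulVec x = (α + γ * l) • x ↔ A.mulVec x = l • x := by
  rw [Matrix.add_mulVec, Matrix.smul_mulVec, Matrix.smul_mulVec, Matrix.one_mulVec, add_smul,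
    mul_smul, add_right_inj]
  exact smul_right_inj hγ

/-- The kernels of the powers of `f = A - l` stabilize at the first step: `γ f = M - μ`, and `M` has
no Jordan block for `μ`. -/
lemma genEigenspace_of_dominant [DecidableEq V] {A : Matrix V V ℝ} {α γ l : ℝ} (hγ : γ ≠ 0)
    (h : IsDominantEigenvalue (α • (1 : Matrix V V ℝ) + γ • A) q (α + γ * l)) (x : V → ℝ) :
    x ∈ genEigenspace A l ↔ (α • (1 : Matrix V V ℝ) + γ • A).mulVec x = (α + γ * l) • x := by
  rw [mulVec_affine_eq_iff hγ, genEigenspace, Module.End.mem_maxGenEigenspace]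
  set f := Matrix.toLin' A - l • (1 : Module.End ℝ (V → ℝ)) with hf
  have hfx : ∀ y, f y = A.mulVec y - l • y := fun y => by simp [hf]
  have hker : ∀ y, f (f y) = 0 → f y = 0 := by
    intro y hy
    rw [hfx, sub_eq_zero] at hy
    have e : (α • (1 : Matrix V V ℝ) + γ • A).mulVec y - (α + γ * l) • y = γ • f y := by
      rw [hfx, Matrix.add_mulVec, Matrix.smul_mulVec, Matrix.smul_mulVec, Matrix.one_mulVec,
        add_smul, mul_smul, smul_sub]
      abel
    have h1 := h.eq_zero_of_sub_smul (x := y) (by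
      rw [e, Matrix.mulVec_smul, (mulVec_affine_eq_iff hγ).2 hy, smul_comm])
    rw [e] at h1
    exact (smul_eq_zero.1 h1).resolve_left hγ
  have hpow : ∀ k, (f ^ k) x = 0 → f x = 0 := by
    intro k
    induction k with
    | zero => intro h0; simp at h0; simp [h0]
    | succ k ih =>
      intro hk
      rcases Nat.eq_zero_or_pos k with rfl | hkpos
      · simpa using hk
      · obtain ⟨m, rfl⟩ := Nat.exists_eq_succ_of_ne_zero hkpos.ne'
        apply ih
        rw [pow_succ', Module.End.mul_apply]
        apply hker
        rwa [pow_succ', pow_succ', Module.End.mul_apply, Module.End.mul_apply] at hk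
  rw [← sub_eq_zero, ← hfx]
  exact ⟨fun ⟨k, hk⟩ => hpow k hk, fun h0 => ⟨1, by simpa using h0⟩⟩

lemma mem_eigenRealParts [DecidableEq V] {A : Matrix V V ℝ} {l : ℝ} {w : V → ℝ} (hw : w ≠ 0)
    (h : A.mulVec w = l • w) : l ∈ eigenRealParts A := by
  refine ⟨(l : ℂ), ?_, Complex.ofReal_re l⟩
  rw [← Matrix.spectrum_toLin', ← Module.End.hasEigenvalue_iff_mem_spectrum]
  refine Module.End.hasEigenvalue_of_hasEigenvector (x := fun i => (w i : ℂ)) ?_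
  rw [Module.End.hasEigenvector_iff, Module.End.mem_eigenspace_iff]
  constructor
  · funext i
    have := congrFun h i
    simp only [Matrix.mulVec, dotProduct, Pi.smul_apply, smul_eq_mul] at this
    simp only [Matrix.toLin'_apply, Matrix.mulVec, dotProduct, Matrix.map_apply,
      Complex.coe_algebraMap, Pi.smul_apply, smul_eq_mul]
    exact_mod_cast this
  · intro h0
    apply hw
    funext i
    have := congrFun h0 i
    simpa using this

lemma exists_of_mem_eigenRealParts [DecidableEq V] {A : Matrix V V ℝ} {r : ℝ}
    (h : r ∈ eigenRealParts A) : ∃ (s : ℝ) (a b : V → ℝ), (a ≠ 0 ∨ b ≠ 0) ∧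
      A.mulVec a = r • a - s • b ∧ A.mulVec b = r • b + s • a := by
  obtain ⟨c, hc, rfl⟩ := h
  rw [← Matrix.spectrum_toLin', ← Module.End.hasEigenvalue_iff_mem_spectrum] at hc
  obtain ⟨z, hz⟩ := hc.exists_hasEigenvector
  rw [Module.End.hasEigenvector_iff, Module.End.mem_eigenspace_iff] at hz
  obtain ⟨hz, hz0⟩ := hz
  refine ⟨c.im, fun i => (z i).re, fun i => (z i).im, ?_, ?_, ?_⟩
  · by_contra! hcon
    apply hz0
    funext i
    exact Complex.ext (congrFun hcon.1 i) (congrFun hcon.2 i)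
  · funext i
    have := congrArg Complex.re (congrFun hz i)
    simpa [Matrix.mulVec, dotProduct] using this
  · funext i
    have := congrArg Complex.im (congrFun hz i)
    simpa [Matrix.mulVec, dotProduct] using this

/-- For the real and imaginary parts `a`, `b` of a complex eigenvector, the cross terms `± s ⟨a, b⟩`
cancel when the two dissipation inequalities are added. -/
lemma IsDominantEigenvalue.le_of_mem_eigenRealParts [DecidableEq V] {A : Matrix V V ℝ}
    {α γ μ r : ℝ} (h : IsDominantEigenvalue (α • (1 : Matrix V V ℝ) + γ • A) q μ)
    (hr : r ∈ eigenRealParts A) : α + γ * r ≤ μ := by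
  obtain ⟨s, a, b, hab, ha, hb⟩ := exists_of_mem_eigenRealParts hr
  have h1 := h.wdot_mulVec_le a
  have h2 := h.wdot_mulVec_le b
  simp only [Matrix.add_mulVec, Matrix.smul_mulVec, Matrix.one_mulVec, ha, hb, wdot_add_right,
    wdot_smul_right, wdot_sub_right, wdot_comm q b a] at h1 h2
  have h3 : 0 < wdot q a a + wdot q b b := by
    rcases hab with h0 | h0
    · linarith [wdot_self_pos h.weight_pos h0, wdot_self_nonneg h.weight_pos b]
    · linarith [wdot_self_pos h.weight_pos h0, wdot_self_nonneg h.weight_pos a]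
  nlinarith

lemma lambdaMax_eq_of_dominant [DecidableEq V] {A : Matrix V V ℝ} {α γ l : ℝ} (hγ : 0 < γ)
    (h : IsDominantEigenvalue (α • (1 : Matrix V V ℝ) + γ • A) q (α + γ * l)) :
    lambdaMax A = l := by
  obtain ⟨w, hw0, hw⟩ := h.exists_eigenvector
  refine IsGreatest.csSup_eq ⟨mem_eigenRealParts hw0 ((mulVec_affine_eq_iff hγ.ne').1 hw), ?_⟩
  intro r hr
  have := h.le_of_mem_eigenRealParts hr
  exact le_of_mul_le_mul_left (by linarith) hγ

lemma lambdaMin_eq_of_dominant [DecidableEq V] {A : Matrix V V ℝ} {α γ l : ℝ} (hγ : γ < 0)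
    (h : IsDominantEigenvalue (α • (1 : Matrix V V ℝ) + γ • A) q (α + γ * l)) :
    lambdaMin A = l := by
  obtain ⟨w, hw0, hw⟩ := h.exists_eigenvector
  refine IsLeast.csInf_eq ⟨mem_eigenRealParts hw0 ((mulVec_affine_eq_iff hγ.ne).1 hw), ?_⟩
  intro r hr
  have := h.le_of_mem_eigenRealParts hr
  nlinarith

end WeightedForm

/-! ### Exponential stability below the bifurcation value, and existence of solutions. -/

section Stability

variable {V : Type*} [Fintype V]

/-- The vector field `x ↦ -d x + u S(M x)`. -/
def satField (S : ℝ → ℝ) (d : ℝ) (M : Matrix V V ℝ) (u : ℝ) (x : V → ℝ) : V → ℝ :=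
  fun i => -d * x i + u * S (M.mulVec x i)

lemma opinionField_eq_satField [DecidableEq V] (S : ℝ → ℝ) (d α γ : ℝ) (A : Matrix V V ℝ) :
    opinionField S d α γ A = satField S d (α • (1 : Matrix V V ℝ) + γ • A) := by
  funext u x i
  simp only [opinionField, satField, Matrix.add_mulVec, Matrix.smul_mulVec, Matrix.one_mulVec]
  rfl

/-- The nonlinear remainder `S(M x) - M x`. -/
def satRem (S : ℝ → ℝ) (M : Matrix V V ℝ) (x : V → ℝ) : V → ℝ :=
  fun i => S (M.mulVec x i) - M.mulVec x i

variable {S : ℝ → ℝ} {d u μ : ℝ} {M : Matrix V V ℝ} {q : V → ℝ}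

lemma satField_eq (x : V → ℝ) :
    satField S d M u x = (-d) • x + u • M.mulVec x + u • satRem S M x := by
  funext i
  simp only [satField, satRem, Pi.add_apply, Pi.smul_apply, smul_eq_mul]
  ring

lemma satField_zero (hS : IsSaturating S) : satField S d M u 0 = 0 := by
  funext i
  simp [satField, hS.map_zero]

lemma exists_norm_satRem_le [DecidableEq V] (hS : IsSaturating S) (M : Matrix V V ℝ) :
    ∃ C > 0, ∀ x, ‖satRem S M x‖ ≤ C * ‖x‖ ^ 2 := by
  obtain ⟨C, hC, h⟩ := hS.exists_abs_sub_le_sq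
  obtain ⟨L, hL, hM⟩ := exists_norm_mulVec_le M
  refine ⟨C * L ^ 2, by positivity, fun x => ?_⟩
  rw [pi_norm_le_iff_of_nonneg (by positivity)]
  intro i
  have h1 : |M.mulVec x i| ≤ L * ‖x‖ := (norm_le_pi_norm (M.mulVec x) i).trans (hM x)
  calc ‖satRem S M x i‖ ≤ C * (M.mulVec x i) ^ 2 := h _
    _ = C * |M.mulVec x i| ^ 2 := by rw [sq_abs]
    _ ≤ C * (L * ‖x‖) ^ 2 := by gcongr
    _ = _ := by ring

lemma exists_wdot_satRem_le [DecidableEq V] (hS : IsSaturating S) (M : Matrix V V ℝ)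
    (hq : ∀ i, 0 < q i) :
    ∃ K > 0, ∀ x, wdot q (satRem S M x) (satRem S M x) ≤ (K * wdot q x x) ^ 2 := by
  obtain ⟨C, hC, h⟩ := exists_norm_satRem_le hS M
  obtain ⟨a, ha, ha'⟩ := exists_norm_sq_le_wdot_self hq
  obtain ⟨b, hb, hb'⟩ := exists_wdot_self_le hq
  refine ⟨(b + 1) * C * a, by positivity, fun x => ?_⟩
  have hx := wdot_self_nonneg hq x
  calc _ ≤ b * ‖satRem S M x‖ ^ 2 := hb' _
    _ ≤ (b + 1) ^ 2 * (C * (a * wdot q x x)) ^ 2 := by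
      gcongr
      · nlinarith
      · exact (h x).trans (by gcongr; exact ha' x)
    _ = _ := by ring

lemma isLocallyExpStable_of_wdot_le {f : (V → ℝ) → V → ℝ} (hf : f 0 = 0) (hq : ∀ i, 0 < q i)
    {ρ c : ℝ} (hρ : 0 < ρ) (hc : 0 < c)
    (h : ∀ x, wdot q x x ≤ ρ → wdot q x (f x) ≤ -c * wdot q x x) : IsLocallyExpStable f := by
  obtain ⟨a, ha, ha'⟩ := exists_norm_sq_le_wdot_self hq
  obtain ⟨b, hb, hb'⟩ := exists_wdot_self_le hq
  refine ⟨hf, √(ρ / b), by positivity, √(a * b), by positivity, c / 2, by positivity, ?_⟩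
  intro T hT x hx hx0 t ht
  have hQ0 : wdot q (x 0) (x 0) < ρ := by
    rw [Real.lt_sqrt (norm_nonneg _), lt_div_iff₀ hb] at hx0
    linarith [hb' (x 0)]
  have hcont : ContinuousOn (fun t => wdot q (x t) (x t)) (Set.Icc 0 T) :=
    fun t ht => (hx t ht).wdot_self.continuousWithinAt
  have hder : ∀ t ∈ Set.Ico 0 T, HasDerivWithinAt (fun t => wdot q (x t) (x t))
      (2 * wdot q (x t) (f (x t))) (Set.Ici t) t := fun t ht =>
    (hx t (Set.Ico_subset_Icc_self ht)).wdot_self.mono_of_mem_nhdsWithin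
      (Icc_mem_nhdsGE_of_mem ht)
  have hexp : ∀ (K t : ℝ), HasDerivAt (fun t => K * Real.exp (-c * t))
      (K * (Real.exp (-c * t) * -c)) t := fun K t => by
    have := ((hasDerivAt_id' t).const_mul (-c)).exp.const_mul K
    simpa using this
  -- The barrier `K * exp (-c t)` decays at half the guaranteed rate `2c`, which makes the
  -- comparison strict at contact, and there it is still below `ρ`. Taking `K` above the initial
  -- value keeps it positive; `K` is then lowered to that value.
  have key : ∀ K, wdot q (x 0) (x 0) < K → K < ρ →
      wdot q (x t) (x t) ≤ K * Real.exp (-c * t) := by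
    intro K hK hKρ
    have hK0 : 0 < K := (wdot_self_nonneg hq _).trans_lt hK
    refine image_le_of_deriv_right_lt_deriv_boundary hcont hder (by simpa using hK.le) (hexp K)
      ?_ ht
    intro s hs heq
    have hpos : 0 < K * Real.exp (-c * s) := by positivity
    have hle : K * Real.exp (-c * s) ≤ K := by
      have : Real.exp (-c * s) ≤ 1 := Real.exp_le_one_iff.2 (by nlinarith [hs.1])
      nlinarith
    have := h (x s) (by linarith)
    rw [heq] at this
    nlinarith
  have hfin : wdot q (x t) (x t) ≤ wdot q (x 0) (x 0) * Real.exp (-c * t) := by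
    by_contra! hcon
    rw [← lt_div_iff₀ (Real.exp_pos _)] at hcon
    obtain ⟨K, hK1, hK2⟩ := exists_between (lt_min hQ0 hcon)
    have h1 := key K hK1 (hK2.trans_le (min_le_left _ _))
    have h2 := hK2.trans_le (min_le_right _ _)
    rw [lt_div_iff₀ (Real.exp_pos _)] at h2
    linarith
  have he : Real.exp (-c * t) = Real.exp (-(c / 2) * t) ^ 2 := by
    rw [← Real.exp_nat_mul]
    congr 1
    push_cast
    ring
  refine le_of_sq_le_sq ?_ (by positivity)
  calc ‖x t‖ ^ 2 ≤ a * wdot q (x t) (x t) := ha' _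
    _ ≤ a * (b * ‖x 0‖ ^ 2 * Real.exp (-c * t)) := by
      gcongr
      exact hfin.trans (by gcongr; exact hb' _)
    _ = _ := by
      rw [mul_pow, mul_pow, Real.sq_sqrt (by positivity), he]
      ring

lemma IsDominantEigenvalue.isLocallyExpStable [DecidableEq V] (hS : IsSaturating S)
    (h : IsDominantEigenvalue M q μ) (hu : 0 ≤ u) (hud : u * μ < d) :
    IsLocallyExpStable (satField S d M u) := by
  obtain ⟨K, hK, hKr⟩ := exists_wdot_satRem_le hS M h.weight_pos
  -- Half of the spectral gap absorbs the remainder; the other half is the decay rate.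
  set c := (d - u * μ) / 2 with hc
  have hc0 : 0 < c := by rw [hc]; linarith
  have hK1 : 0 < u * K + 1 := by positivity
  refine isLocallyExpStable_of_wdot_le (satField_zero hS) h.weight_pos
    (ρ := (c / (u * K + 1)) ^ 2) (by positivity) hc0 fun x hx => ?_
  have hxx := wdot_self_nonneg h.weight_pos x
  set Q := wdot q x x with hQ
  have h1 : wdot q x (satRem S M x) ≤ c / (u * K + 1) * (K * Q) := by
    refine abs_le_of_sq_le_sq' ?_ (by positivity) |>.2
    calc wdot q x (satRem S M x) ^ 2 ≤ Q * wdot q (satRem S M x) (satRem S M x) :=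
        wdot_sq_le h.weight_pos _ _
      _ ≤ (c / (u * K + 1)) ^ 2 * (K * Q) ^ 2 :=
        mul_le_mul hx (hKr x) (wdot_self_nonneg h.weight_pos _) (by positivity)
      _ = _ := by ring
  have h2 : u * (c / (u * K + 1) * (K * Q)) ≤ c * Q := by
    have : u * (c / (u * K + 1) * (K * Q)) = u * K / (u * K + 1) * (c * Q) := by field_simp
    rw [this]
    have : u * K / (u * K + 1) ≤ 1 := by rw [div_le_one hK1]; linarith
    have h0 : 0 ≤ c * Q := by positivity
    nlinarith
  rw [satField_eq, wdot_add_right, wdot_add_right, wdot_smul_right, wdot_smul_right,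
    wdot_smul_right]
  have h3 := mul_le_mul_of_nonneg_left (h.wdot_mulVec_le x) hu
  have h4 := mul_le_mul_of_nonneg_left h1 hu
  rw [← hQ] at h3 ⊢
  have : d = u * μ + 2 * c := by rw [hc]; ring
  rw [this]
  nlinarith

/-- Substituting `x = exp (-d t) z` removes the linear term. The field for `z` is bounded by `D` on
`[0, T]`, so a ball of radius `D * T` suffices for Picard–Lindelöf on the whole interval.
Instability needs such solutions to exist. -/
lemma exists_isIntegralCurveOn_satField [DecidableEq V] (hS : IsSaturating S) (d u : ℝ)
    (M : Matrix V V ℝ) (x₀ : V → ℝ) {T : ℝ} (hT : 0 < T) :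
    ∃ x : ℝ → V → ℝ, x 0 = x₀ ∧
      IsIntegralCurveOn x (fun _ => satField S d M u) (Set.Icc 0 T) := by
  obtain ⟨B, hB⟩ := hS.bounded
  obtain ⟨L, hL, hM⟩ := exists_norm_mulVec_le M
  have hB0 : 0 ≤ B := (abs_nonneg _).trans (hB 0)
  set G : ℝ → (V → ℝ) → V → ℝ := fun t z i =>
    Real.exp (d * t) * (u * S (Real.exp (-(d * t)) * M.mulVec z i)) with hG
  set D := Real.exp (|d| * T) * (|u| * B) with hD
  have hD0 : 0 ≤ D := by positivity
  have hpl : IsPicardLindelof G (tmin := 0) (tmax := T) ⟨0, by simp [hT.le]⟩ x₀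
      (.mk (D * T) (by positivity)) 0 (.mk D hD0) (.mk (|u| * L) (by positivity)) := by
    refine ⟨fun t ht => LipschitzOnWith.of_dist_le_mul fun y _ z _ => ?_, fun z hz => ?_,
      fun t ht z hz => ?_, ?_⟩
    · rw [NNReal.coe_mk, dist_pi_le_iff (by positivity)]
      intro i
      have e := Real.exp_pos (d * t)
      have h1 : |S (Real.exp (-(d * t)) * M.mulVec y i) - S (Real.exp (-(d * t)) * M.mulVec z i)|
          ≤ Real.exp (-(d * t)) * (L * dist y z) := by
        have := hS.lipschitz.dist_le_mul (Real.exp (-(d * t)) * M.mulVec y i)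
          (Real.exp (-(d * t)) * M.mulVec z i)
        rw [Real.dist_eq, Real.dist_eq, NNReal.coe_one, one_mul, ← mul_sub, abs_mul, abs_of_pos
          (Real.exp_pos _)] at this
        refine this.trans ?_
        gcongr
        rw [dist_eq_norm]
        have h2 := (norm_le_pi_norm (M.mulVec (y - z)) i).trans (hM _)
        rwa [Matrix.mulVec_sub] at h2
      simp only [hG]
      rw [Real.dist_eq, ← mul_sub, ← mul_sub, abs_mul, abs_mul, abs_of_pos e]
      calc _ ≤ Real.exp (d * t) * (|u| * (Real.exp (-(d * t)) * (L * dist y z))) := by gcongr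
        _ = (Real.exp (d * t) * Real.exp (-(d * t))) * (|u| * L * dist y z) := by ring
        _ = _ := by rw [← Real.exp_add, add_neg_cancel, Real.exp_zero, one_mul]
    · apply Continuous.continuousOn
      refine continuous_pi fun i => ?_
      have := hS.continuous
      fun_prop
    · rw [NNReal.coe_mk, pi_norm_le_iff_of_nonneg hD0]
      intro i
      simp only [hG]
      rw [Real.norm_eq_abs, abs_mul, abs_mul, abs_of_pos (Real.exp_pos _), hD]
      gcongr
      · exact ht.1
      · exact le_abs_self d
      · exact ht.2
      · exact hB _
    · simp only [NNReal.coe_mk, NNReal.coe_zero, sub_zero, sub_self, max_eq_left hT.le]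
      exact le_rfl
  obtain ⟨z, hz0, hz⟩ := hpl.exists_eq_forall_mem_Icc_hasDerivWithinAt₀
  refine ⟨fun t => Real.exp (-(d * t)) • z t, by simpa using hz0, fun t ht => ?_⟩
  have he : HasDerivWithinAt (fun t => Real.exp (-(d * t))) (Real.exp (-(d * t)) * -d)
      (Set.Icc 0 T) t := by
    have := ((hasDerivAt_id' t).const_mul d).neg.exp.hasDerivWithinAt (s := Set.Icc 0 T)
    simpa using this
  refine (he.smul (hz t ht)).congr_deriv ?_
  funext i
  simp only [satField, hG, Matrix.mulVec_smul, Pi.add_apply, Pi.smul_apply, smul_eq_mul]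
  rw [← mul_assoc (Real.exp (-(d * t))) (Real.exp (d * t)), ← Real.exp_add, neg_add_cancel,
    Real.exp_zero]
  ring

end Stability

/-! ### Instability above the bifurcation value. -/

section Instability

variable {V : Type*} [Fintype V] {S : ℝ → ℝ} {d u μ : ℝ} {M : Matrix V V ℝ} {q : V → ℝ}

lemma exists_normalized_eigenvector (h : IsDominantEigenvalue M q μ) :
    ∃ w, wdot q w w = 1 ∧ M.mulVec w = μ • w := by
  obtain ⟨w, hw0, hw⟩ := h.exists_eigenvector
  have hpos := wdot_self_pos h.weight_pos hw0
  refine ⟨(√(wdot q w w))⁻¹ • w, ?_, ?_⟩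
  · rw [wdot_smul_left, wdot_smul_right, ← mul_assoc, ← mul_inv, Real.mul_self_sqrt hpos.le,
      inv_mul_cancel₀ hpos.ne']
  · rw [Matrix.mulVec_smul, hw, smul_comm]

/-- A solution that starts at a small multiple `δ w` of a dominant eigenvector follows the
linearized solution `δ exp(ct) w` up to an error that is quadratic in `δ exp(ct)`. -/
lemma wdot_deviation_le (h : IsDominantEigenvalue M q μ) {c K H δ T : ℝ} (hu : 0 ≤ u)
    (hc : c = u * μ - d) (hc0 : 0 < c) (hK : 0 < K)
    (hKr : ∀ x, wdot q (satRem S M x) (satRem S M x) ≤ (K * wdot q x x) ^ 2)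
    (hH : c * H = 4 * u * K + 1) (hδ : 0 < δ) (hT : H * (δ * Real.exp (c * T)) ≤ 1)
    {w : V → ℝ} (hw1 : wdot q w w = 1) (hw : M.mulVec w = μ • w) {x : ℝ → V → ℝ}
    (hx0 : x 0 = δ • w) (hx : IsIntegralCurveOn x (fun _ => satField S d M u) (Set.Icc 0 T)) :
    ∀ t ∈ Set.Icc 0 T, wdot q (x t - (δ * Real.exp (c * t)) • w) (x t - (δ * Real.exp (c * t)) • w)
      ≤ (H * δ ^ 2) ^ 2 * Real.exp (4 * c * t) := by
  have hq := h.weight_pos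
  have hH0 : 0 < H := pos_of_mul_pos_right (by rw [hH]; positivity) hc0.le
  set y : ℝ → V → ℝ := fun t => x t - (δ * Real.exp (c * t)) • w with hy
  have hyder : ∀ t ∈ Set.Icc 0 T, HasDerivWithinAt y
      (satField S d M u (x t) - (c * (δ * Real.exp (c * t))) • w) (Set.Icc 0 T) t := by
    intro t ht
    have he : HasDerivWithinAt (fun t => δ * Real.exp (c * t)) (c * (δ * Real.exp (c * t)))
        (Set.Icc 0 T) t := by
      have := (((hasDerivAt_id' t).const_mul c).exp.const_mul δ).hasDerivWithinAt
        (s := Set.Icc 0 T)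
      refine this.congr_deriv ?_
      ring
    exact (hx t ht).sub (he.smul_const w)
  have hcont : ContinuousOn (fun t => wdot q (y t) (y t)) (Set.Icc 0 T) :=
    fun t ht => (hyder t ht).wdot_self.continuousWithinAt
  have hB : ∀ t, HasDerivAt (fun t => (H * δ ^ 2) ^ 2 * Real.exp (4 * c * t))
      ((H * δ ^ 2) ^ 2 * (Real.exp (4 * c * t) * (4 * c))) t := fun t => by
    have := ((hasDerivAt_id' t).const_mul (4 * c)).exp.const_mul ((H * δ ^ 2) ^ 2)
    simpa using this
  -- With `E = δ * exp (c t)` the barrier is `(H E²)²`, growing at rate `4c`. At contact the linear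
  -- part contributes at most `2c (H E²)²`, and the remainder at most `2 (c H - 1) H E⁴`, since `H E
  -- ≤ 1` gives `⟨x, x⟩ ≤ 4 E²`. The `+ 1` in `hH` makes the total strictly smaller.
  refine image_le_of_deriv_right_lt_deriv_boundary hcont
    (fun t ht => (hyder t (Set.Ico_subset_Icc_self ht)).wdot_self.mono_of_mem_nhdsWithin
      (Icc_mem_nhdsGE_of_mem ht)) ?_ hB ?_
  · simp only [hy, hx0, mul_zero, Real.exp_zero, mul_one, sub_self, wdot_zero_right]
    positivity
  intro t ht heq
  set E := δ * Real.exp (c * t) with hE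
  have hE0 : 0 < E := by positivity
  have hEE : (H * δ ^ 2) ^ 2 * Real.exp (4 * c * t) = (H * E ^ 2) ^ 2 := by
    have : Real.exp (4 * c * t) = Real.exp (c * t) ^ 4 := by
      rw [← Real.exp_nat_mul]; congr 1; push_cast; ring
    rw [this, hE]; ring
  have hHE : H * E ≤ 1 := by
    refine le_trans ?_ hT
    rw [hE]
    gcongr
    exact ht.2.le
  rw [hEE] at heq
  have hxt : x t = E • w + y t := by simp [hy, hE]
  have hxx : wdot q (x t) (x t) ≤ 4 * E ^ 2 := by
    have h1 := wdot_add_self_le hq (E • w) (y t)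
    rw [← hxt, wdot_smul_left, wdot_smul_right, hw1, heq] at h1
    have h2 : (H * E ^ 2) ^ 2 ≤ E ^ 2 := by
      calc (H * E ^ 2) ^ 2 = (H * E) ^ 2 * E ^ 2 := by ring
        _ ≤ 1 ^ 2 * E ^ 2 := by gcongr
        _ = E ^ 2 := by ring
    nlinarith
  have hrem : wdot q (y t) (satRem S M (x t)) ≤ H * E ^ 2 * (K * (4 * E ^ 2)) := by
    refine (abs_le_of_sq_le_sq' ?_ (by positivity)).2
    have hr : wdot q (satRem S M (x t)) (satRem S M (x t)) ≤ (K * (4 * E ^ 2)) ^ 2 := by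
      refine (hKr _).trans ?_
      have := wdot_self_nonneg hq (x t)
      gcongr
    calc _ ≤ _ := wdot_sq_le hq _ _
      _ ≤ (H * E ^ 2) ^ 2 * (K * (4 * E ^ 2)) ^ 2 := by rw [heq]; gcongr
      _ = _ := by ring
  have hf : satField S d M u (x t) - (c * E) • w =
      (-d) • y t + u • M.mulVec (y t) + u • satRem S M (x t) := by
    have hMx : M.mulVec (x t) = (E * μ) • w + M.mulVec (y t) := by
      conv_lhs => rw [hxt]
      rw [Matrix.mulVec_add, Matrix.mulVec_smul, hw, smul_smul]
    rw [satField_eq, hMx]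
    nth_rewrite 1 [hxt]
    rw [hc]
    module
  rw [hf, wdot_add_right, wdot_add_right, wdot_smul_right, wdot_smul_right, wdot_smul_right]
  have h3 := mul_le_mul_of_nonneg_left (h.wdot_mulVec_le (y t)) hu
  have h4 := mul_le_mul_of_nonneg_left hrem hu
  rw [heq] at h3 ⊢
  have h5 : (H * δ ^ 2) ^ 2 * (Real.exp (4 * c * t) * (4 * c)) = 4 * c * (H * E ^ 2) ^ 2 := by
    rw [← hEE]; ring
  rw [h5]
  have hd : d = u * μ - c := by rw [hc]; ring
  have h6 : u * (H * E ^ 2 * (K * (4 * E ^ 2))) = (c * H - 1) * H * E ^ 4 := by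
    rw [hH]; ring
  rw [h6] at h4
  rw [hd]
  have h7 : 0 < H * E ^ 4 := by positivity
  nlinarith

lemma IsDominantEigenvalue.isUnstable [DecidableEq V] (hS : IsSaturating S)
    (h : IsDominantEigenvalue M q μ) (hu : 0 ≤ u) (hud : d < u * μ) :
    IsUnstable (satField S d M u) := by
  refine ⟨satField_zero hS, fun hst => ?_⟩
  have hq := h.weight_pos
  obtain ⟨K, hK, hKr⟩ := exists_wdot_satRem_le hS M hq
  obtain ⟨w, hw1, hw⟩ := exists_normalized_eigenvector h
  obtain ⟨b, hb, hb'⟩ := exists_wdot_self_le hq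
  obtain ⟨c, hc⟩ : ∃ c, c = u * μ - d := ⟨_, rfl⟩
  have hc0 : 0 < c := by linarith
  obtain ⟨H, hH⟩ : ∃ H, c * H = 4 * u * K + 1 := ⟨(4 * u * K + 1) / c, by field_simp⟩
  have hH0 : 0 < H := pos_of_mul_pos_right (by rw [hH]; positivity) hc0.le
  obtain ⟨δ₀, hδ₀, hδ⟩ := hst.2 (1 / (4 * H * (b + 1))) (by positivity)
  set δ := min (δ₀ / (‖w‖ + 1)) (1 / (2 * H)) / 2 with hδdef
  have hm : 0 < min (δ₀ / (‖w‖ + 1)) (1 / (2 * H)) := lt_min (by positivity) (by positivity)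
  have hδ0 : 0 < δ := by positivity
  have hδ1 : δ < δ₀ / (‖w‖ + 1) := (half_lt_self hm).trans_le (min_le_left _ _)
  have hδ2 : δ < 1 / (2 * H) := (half_lt_self hm).trans_le (min_le_right _ _)
  clear_value δ
  rw [lt_div_iff₀ (by positivity)] at hδ1 hδ2
  -- At this time the linearized solution has weighted norm `1 / (2 * H)` and the deviation at most
  -- `1 / (4 * H)`, so the state has weighted norm at least `1 / (4 * H)`, whatever `δ` is.
  set T := Real.log (1 / (2 * H * δ)) / c with hT
  have hT0 : 0 < T := by
    refine div_pos (Real.log_pos ?_) hc0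
    rw [lt_div_iff₀ (by positivity)]
    linarith
  have hET : Real.exp (c * T) = 1 / (2 * H * δ) := by
    rw [hT, mul_div_cancel₀ _ hc0.ne', Real.exp_log (by positivity)]
  have hE : δ * Real.exp (c * T) = 1 / (2 * H) := by rw [hET]; field_simp
  obtain ⟨x, hx0, hx⟩ := exists_isIntegralCurveOn_satField hS d u M (δ • w) hT0
  have hsmall := hδ T hT0 x hx (by
    rw [hx0, norm_smul, Real.norm_eq_abs, abs_of_pos hδ0]
    nlinarith [norm_nonneg w]) T ⟨hT0.le, le_rfl⟩
  have hdev := wdot_deviation_le h hu hc hc0 hK hKr hH hδ0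
    (by rw [hE]; field_simp; norm_num) hw1 hw hx0 hx T ⟨hT0.le, le_rfl⟩
  have h4 : (H * δ ^ 2) ^ 2 * Real.exp (4 * c * T) = 1 / (16 * H ^ 2) := by
    have : Real.exp (4 * c * T) = Real.exp (c * T) ^ 4 := by
      rw [← Real.exp_nat_mul]; congr 1; push_cast; ring
    rw [this, hET]
    field_simp
    norm_num
  rw [h4, hE] at hdev
  have h5 := wdot_add_self_le hq (x T) (-(x T - (1 / (2 * H)) • w))
  have h6 : x T + -(x T - (1 / (2 * H)) • w) = (1 / (2 * H)) • w := by abel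
  have h7 : wdot q (-(x T - (1 / (2 * H)) • w)) (-(x T - (1 / (2 * H)) • w)) =
      wdot q (x T - (1 / (2 * H)) • w) (x T - (1 / (2 * H)) • w) := by
    rw [← neg_one_smul ℝ, wdot_smul_left, wdot_smul_right]; ring
  rw [h6, h7, wdot_smul_left, wdot_smul_right, hw1] at h5
  have h8 : wdot q (x T) (x T) < 1 / (16 * H ^ 2) := by
    calc wdot q (x T) (x T) ≤ b * ‖x T‖ ^ 2 := hb' _
      _ ≤ b * (1 / (4 * H * (b + 1))) ^ 2 := by gcongr
      _ = 1 / (16 * H ^ 2) * (b / (b + 1) ^ 2) := by field_simp; norm_num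
      _ < 1 / (16 * H ^ 2) * 1 := by
        gcongr
        rw [div_lt_one (by positivity)]
        nlinarith
      _ = _ := mul_one _
  have h9 : 1 / (2 * H) * (1 / (2 * H) * 1) = 4 * (1 / (16 * H ^ 2)) := by field_simp; norm_num
  rw [h9] at h5
  linarith

end Instability

/-! ### Equilibria near the bifurcation point. -/

lemma exists_selection_tendsto {E : Type*} [NormedAddCommGroup E] {Q : ℝ → E → Prop} {u₀ : ℝ}
    (h : ∀ r > 0, ∀ᶠ u in 𝓝[>] u₀, ∃ x, Q u x ∧ ‖x‖ < r) :
    ∃ x : ℝ → E, (∀ᶠ u in 𝓝[>] u₀, Q u (x u)) ∧ Tendsto x (𝓝[>] u₀) (𝓝 0) := by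
  -- Taking a solution of norm within `u - u₀` of the infimum gives one family that serves every
  -- radius `r`.
  have hex : ∀ u, ∃ x, (∃ y, Q u y) → u₀ < u →
      Q u x ∧ ∀ y, Q u y → ‖x‖ < ‖y‖ + (u - u₀) := by
    intro u
    by_cases hu : (∃ y, Q u y) ∧ u₀ < u
    · have hne : ((fun y : E => ‖y‖) '' {y | Q u y}).Nonempty :=
        Set.Nonempty.image _ (show {y | Q u y}.Nonempty from hu.1)
      have hbdd : BddBelow ((fun y : E => ‖y‖) '' {y | Q u y}) :=
        ⟨0, by rintro _ ⟨y, -, rfl⟩; exact norm_nonneg y⟩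
      obtain ⟨_, ⟨x, hx, rfl⟩, hlt⟩ := exists_lt_of_csInf_lt hne
        (lt_add_of_pos_right _ (sub_pos.2 hu.2))
      refine ⟨x, fun _ _ => ⟨hx, fun y hy => hlt.trans_le ?_⟩⟩
      gcongr
      exact csInf_le hbdd ⟨y, hy, rfl⟩
    · exact ⟨0, fun h1 h2 => absurd ⟨h1, h2⟩ hu⟩
  choose x hx using hex
  refine ⟨x, ?_, ?_⟩
  · filter_upwards [h 1 one_pos, eventually_mem_nhdsWithin] with u ⟨y, hy, _⟩ hu
    exact (hx u ⟨y, hy⟩ hu).1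
  · rw [Metric.tendsto_nhds]
    intro ε hε
    have hlt : ∀ᶠ u in 𝓝[>] u₀, u < u₀ + ε / 2 :=
      (eventually_lt_nhds (by linarith)).filter_mono nhdsWithin_le_nhds
    filter_upwards [h (ε / 2) (by linarith), eventually_mem_nhdsWithin, hlt]
      with u ⟨y, hy, hyr⟩ hu hu'
    have := (hx u ⟨y, hy⟩ hu).2 y hy
    rw [dist_zero_right]
    linarith

/-- For a linear right inverse `g` of `f` onto its range, `x - g (f x)` lies in the kernel, at
distance `‖g (f x)‖` from `x`. -/
lemma exists_infDist_ker_le {E : Type*} [NormedAddCommGroup E] [NormedSpace ℝ E]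
    [FiniteDimensional ℝ E] (f : E →ₗ[ℝ] E) :
    ∃ C > 0, ∀ x, Metric.infDist x (LinearMap.ker f : Set E) ≤ C * ‖f x‖ := by
  obtain ⟨g, hg⟩ := f.rangeRestrict.exists_rightInverse_of_surjective f.range_rangeRestrict
  obtain ⟨C, hC, h⟩ := (LinearMap.toContinuousLinearMap g).bound
  refine ⟨C, hC, fun x => ?_⟩
  have hmem : x - g (f.rangeRestrict x) ∈ LinearMap.ker f := by
    rw [← f.ker_rangeRestrict, LinearMap.mem_ker, map_sub, sub_eq_zero]
    exact (LinearMap.congr_fun hg _).symm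
  refine (Metric.infDist_le_dist_of_mem hmem).trans ?_
  rw [dist_eq_norm, sub_sub_cancel]
  exact h (f.rangeRestrict x)

section Equilibria

variable {V : Type*} [Fintype V] {S : ℝ → ℝ} {d u μ : ℝ} {M : Matrix V V ℝ} {q : V → ℝ}

lemma satField_eq_zero_iff {x : V → ℝ} :
    satField S d M u x = 0 ↔ ∀ i, d * x i = u * S (M.mulVec x i) := by
  rw [funext_iff]
  refine forall_congr' fun i => ?_
  simp only [satField, Pi.zero_apply]
  constructor <;> intro h <;> linarith

/-- Nonzero equilibria occur only beyond the bifurcation value. -/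
lemma IsDominantEigenvalue.lt_of_equilibrium (hS : IsSaturating S)
    (h : IsDominantEigenvalue M q μ) (hd : 0 < d) (hu : 0 < u) {x : V → ℝ}
    (hx : satField S d M u x = 0) (hx0 : x ≠ 0) : d / μ < u := by
  rw [satField_eq_zero_iff] at hx
  set s : V → ℝ := fun i => S (M.mulVec x i) with hs
  have hxs : d • x = u • s := funext hx
  have hs0 : s ≠ 0 := by
    intro h0
    rw [h0, smul_zero] at hxs
    exact hx0 ((smul_eq_zero.1 hxs).resolve_left hd.ne')
  -- Saturation puts `S z` strictly between `0` and `z`. Testing with `s` instead of `x` turns `⟨s,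
  -- M x⟩` into a multiple of `⟨s, M s⟩`, so no symmetry of `M` is needed.
  have h1 : wdot q s s < wdot q s (M.mulVec x) := by
    obtain ⟨i, hi⟩ := Function.ne_iff.1 hs0
    refine Finset.sum_lt_sum (fun j _ => mul_le_mul_of_nonneg_left (hS.sq_le_mul _)
      (h.weight_pos j).le) ⟨i, Finset.mem_univ i, mul_lt_mul_of_pos_left (hS.sq_lt_mul ?_)
      (h.weight_pos i)⟩
    exact fun h0 => hi (hS.eq_zero_iff.2 h0)
  have h2 : d * wdot q s (M.mulVec x) = u * wdot q s (M.mulVec s) := by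
    rw [← wdot_smul_right, ← wdot_smul_right, ← Matrix.mulVec_smul, ← Matrix.mulVec_smul, hxs]
  have h3 := mul_le_mul_of_nonneg_left (h.wdot_mulVec_le s) hu.le
  have h4 := wdot_self_pos h.weight_pos hs0
  rw [div_lt_iff₀ h.pos]
  have h5 : d * wdot q s s < u * μ * wdot q s s := by nlinarith
  exact lt_of_mul_lt_mul_right h5 h4.le

variable [DecidableEq V]

lemma hasFDerivAt_satField (hS : IsSaturating S) :
    HasFDerivAt (satField S d M u) (LinearMap.toContinuousLinearMap
      ((-d) • LinearMap.id + u • Matrix.toLin' M)) 0 := by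
  obtain ⟨C, -, h⟩ := exists_norm_satRem_le hS M
  have hrem : HasFDerivAt (satRem S M) (0 : (V → ℝ) →L[ℝ] (V → ℝ)) 0 := by
    refine Asymptotics.IsBigO.hasFDerivAt (n := 2) ?_ (by norm_num)
    refine Asymptotics.IsBigO.of_bound C (Eventually.of_forall fun x => ?_)
    simpa using h x
  have h1 := (ContinuousLinearMap.hasFDerivAt (LinearMap.toContinuousLinearMap
    ((-d) • LinearMap.id + u • Matrix.toLin' M)) (x := (0 : V → ℝ))).add (hrem.const_smul u)
  rw [smul_zero, add_zero] at h1
  refine h1.congr_of_eventuallyEq (Eventually.of_forall fun x => ?_)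
  rw [satField_eq]
  simp

/-- At an equilibrium, `(M - μ) x = (1 - u μ / d) M x - (u μ / d) (S(M x) - M x)`. Both terms are
`o(‖x‖)` at the bifurcation point, and they control the distance to the kernel. -/
lemma eventually_infDist_le (hS : IsSaturating S) (hd : 0 < d) (hμ : 0 < μ)
    {W : Submodule ℝ (V → ℝ)} (hW : ∀ x, x ∈ W ↔ M.mulVec x = μ • x) {ε : ℝ} (hε : 0 < ε) :
    ∀ᶠ p : ℝ × (V → ℝ) in 𝓝 (d / μ, 0), satField S d M p.1 p.2 = 0 →
      Metric.infDist p.2 (W : Set (V → ℝ)) ≤ ε * ‖p.2‖ := by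
  obtain ⟨C, hC, hR⟩ := exists_norm_satRem_le hS M
  obtain ⟨L, hL, hM⟩ := exists_norm_mulVec_le M
  obtain ⟨D, hD, hker⟩ := exists_infDist_ker_le (Matrix.toLin' M - μ • LinearMap.id)
  have hWker : W = LinearMap.ker (Matrix.toLin' M - μ • LinearMap.id) := by
    ext x
    simp [hW, sub_eq_zero]
  have hlim : Tendsto (fun p : ℝ × (V → ℝ) =>
      D * (|1 - p.1 * μ / d| * L + |p.1 * μ / d| * (C * ‖p.2‖))) (𝓝 (d / μ, 0)) (𝓝 0) := by
    have : Continuous (fun p : ℝ × (V → ℝ) =>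
      D * (|1 - p.1 * μ / d| * L + |p.1 * μ / d| * (C * ‖p.2‖))) := by fun_prop
    convert this.tendsto (d / μ, 0) using 2
    simp [hd.ne', hμ.ne']
  filter_upwards [hlim.eventually (eventually_le_nhds hε)] with p hp hx
  obtain ⟨u, x⟩ := p
  rw [hWker]
  refine (hker x).trans ?_
  have hJ : (Matrix.toLin' M - μ • (LinearMap.id : (V → ℝ) →ₗ[ℝ] (V → ℝ))) x =
      (1 - u * μ / d) • M.mulVec x - (u * μ / d) • satRem S M x := by
    rw [satField_eq_zero_iff] at hx
    funext i
    have := hx i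
    simp only [LinearMap.sub_apply, Matrix.toLin'_apply, LinearMap.smul_apply, LinearMap.id_apply,
      Pi.sub_apply, Pi.smul_apply, smul_eq_mul, satRem] at this ⊢
    field_simp
    linear_combination (-μ) * this
  rw [hJ]
  calc D * ‖(1 - u * μ / d) • M.mulVec x - (u * μ / d) • satRem S M x‖
      ≤ D * (|1 - u * μ / d| * (L * ‖x‖) + |u * μ / d| * (C * ‖x‖ ^ 2)) := by
        gcongr
        refine (norm_sub_le _ _).trans ?_
        rw [norm_smul, norm_smul, Real.norm_eq_abs, Real.norm_eq_abs]
        gcongr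
        · exact hM x
        · exact hR x
    _ = D * (|1 - u * μ / d| * L + |u * μ / d| * (C * ‖x‖)) * ‖x‖ := by ring
    _ ≤ ε * ‖x‖ := by gcongr

lemma eventually_lt_and_of_equilibrium (hS : IsSaturating S) (h : IsDominantEigenvalue M q μ)
    (hd : 0 < d) {W : Submodule ℝ (V → ℝ)} (hW : ∀ x, x ∈ W ↔ M.mulVec x = μ • x)
    {P : (V → ℝ) → Prop}
    (hP : ∀ᶠ p : ℝ × (V → ℝ) in 𝓝 (d / μ, 0), satField S d M p.1 p.2 = 0 → p.2 ≠ 0 → P p.2)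
    {ε : ℝ} (hε : 0 < ε) :
    ∀ᶠ p : ℝ × (V → ℝ) in 𝓝 (d / μ, 0), satField S d M p.1 p.2 = 0 → p.2 ≠ 0 →
      d / μ < p.1 ∧ P p.2 ∧ Metric.infDist p.2 (W : Set (V → ℝ)) ≤ ε * ‖p.2‖ := by
  have hpos : ∀ᶠ p : ℝ × (V → ℝ) in 𝓝 (d / μ, 0), 0 < p.1 :=
    continuousAt_fst.eventually (lt_mem_nhds (div_pos hd h.pos))
  filter_upwards [hP, hpos, eventually_infDist_le hS hd h.pos hW hε] with p h1 h2 h3 h4 h5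
  exact ⟨h.lt_of_equilibrium hS hd h2 h4 h5, h1 h4 h5, h3 h4⟩

lemma IsDominantEigenvalue.bifurcatesAlong (hS : IsSaturating S) (h : IsDominantEigenvalue M q μ)
    (hd : 0 < d) {W : Submodule ℝ (V → ℝ)} (hW : ∀ x, x ∈ W ↔ M.mulVec x = μ • x)
    {P : (V → ℝ) → Prop}
    (hP : ∀ᶠ p : ℝ × (V → ℝ) in 𝓝 (d / μ, 0), satField S d M p.1 p.2 = 0 → p.2 ≠ 0 → P p.2)
    (hex : ∀ r > 0, ∀ᶠ u in 𝓝[>] (d / μ), ∃ x, (x ≠ 0 ∧ satField S d M u x = 0) ∧ ‖x‖ < r) :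
    BifurcatesAlong (satField S d M) (d / μ) W P where
  trivial_branch _ := satField_zero hS
  ne_bot hbot := by
    obtain ⟨w, hw0, hw⟩ := h.exists_eigenvector
    rw [← hW, hbot, Submodule.mem_bot] at hw
    exact hw0 hw
  differentiable := (hasFDerivAt_satField hS).differentiableAt
  kernel v := by
    rw [(hasFDerivAt_satField hS).fderiv, hW]
    have e : (LinearMap.toContinuousLinearMap
        ((-d) • LinearMap.id + (d / μ) • Matrix.toLin' M)) v =
        (d / μ) • (M.mulVec v - μ • v) := by
      rw [smul_sub, smul_smul, div_mul_cancel₀ _ h.pos.ne']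
      simp [neg_add_eq_sub]
    rw [e, smul_eq_zero, sub_eq_zero]
    simp [hd.ne', h.pos.ne']
  emerge := by
    obtain ⟨x, hx, hlim⟩ := exists_selection_tendsto hex
    refine ⟨x, ?_, hlim⟩
    have h2 : Tendsto (fun u => (u, x u)) (𝓝[>] (d / μ)) (𝓝 (d / μ, 0)) :=
      (tendsto_id.mono_left nhdsWithin_le_nhds).prodMk_nhds hlim
    filter_upwards [hx, h2.eventually hP] with u h3 h4
    exact ⟨h3.1, h3.2, h4 h3.2 h3.1⟩
  nearby _ hε := eventually_lt_and_of_equilibrium hS h hd hW hP hε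

end Equilibria

/-! ### The bifurcation curve for a simple eigenvalue. -/

section Curve

variable {V : Type*} [Fintype V] {S : ℝ → ℝ} {d u μ : ℝ} {M : Matrix V V ℝ} {q w : V → ℝ}

lemma exists_abs_wdot_le (hq : ∀ i, 0 < q i) (w : V → ℝ) :
    ∃ D > 0, ∀ x, |wdot q w x| ≤ D * ‖x‖ := by
  obtain ⟨b, hb, hb'⟩ := exists_wdot_self_le hq
  have hw := wdot_self_nonneg hq w
  refine ⟨wdot q w w + b, by positivity, fun x => abs_le_of_sq_le_sq ?_ (by positivity)⟩
  calc wdot q w x ^ 2 ≤ wdot q w w * wdot q x x := wdot_sq_le hq _ _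
    _ ≤ wdot q w w * (b * ‖x‖ ^ 2) := by gcongr; exact hb' x
    _ ≤ ((wdot q w w + b) * ‖x‖) ^ 2 := by
      rw [mul_pow, ← mul_assoc]
      gcongr
      nlinarith

/-- If the dominant eigenvalue is geometrically simple, small equilibria are close to multiples of
the eigenvector, relative to their size. -/
lemma eventually_norm_inv_smul_sub_lt [DecidableEq V] (hS : IsSaturating S) (h : IsDominantEigenvalue M q μ)
    (hd : 0 < d) (hw1 : wdot q w w = 1) (hw : M.mulVec w = μ • w)
    (hsimple : ∀ x, M.mulVec x = μ • x → ∃ c : ℝ, c • w = x) {η : ℝ} (hη : 0 < η) :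
    ∀ᶠ p : ℝ × (V → ℝ) in 𝓝 (d / μ, 0), satField S d M p.1 p.2 = 0 → p.2 ≠ 0 →
      wdot q w p.2 ≠ 0 ∧ ‖(wdot q w p.2)⁻¹ • p.2 - w‖ < η := by
  obtain ⟨D, hD, hDx⟩ := exists_abs_wdot_le h.weight_pos w
  set C := 1 + D * ‖w‖ with hC
  have hC0 : 0 < C := by positivity
  -- Removing the `w`-component costs a factor `C`. The first bound then gives `‖x‖ ≤ 2 |s| ‖w‖`,
  -- and the second the tolerance `η` after division by `s`.
  set ε := min (1 / (2 * C)) (η / (2 * C * (‖w‖ + 1))) / 2 with hε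
  have hm : 0 < min (1 / (2 * C)) (η / (2 * C * (‖w‖ + 1))) :=
    lt_min (by positivity) (by positivity)
  have hε0 : 0 < ε := by positivity
  have hε1 : ε < 1 / (2 * C) := (half_lt_self hm).trans_le (min_le_left _ _)
  have hε2 : ε < η / (2 * C * (‖w‖ + 1)) := (half_lt_self hm).trans_le (min_le_right _ _)
  rw [lt_div_iff₀ (by positivity)] at hε1 hε2
  have hW : ∀ x, x ∈ Submodule.span ℝ {w} ↔ M.mulVec x = μ • x := by
    intro x
    rw [Submodule.mem_span_singleton]
    refine ⟨?_, hsimple x⟩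
    rintro ⟨c, rfl⟩
    rw [Matrix.mulVec_smul, hw, smul_comm]
  filter_upwards [eventually_infDist_le hS hd h.pos hW hε0] with p hp hpeq hp0
  obtain ⟨u, x⟩ := p
  simp only at hp hpeq hp0 ⊢
  have hclosed : IsClosed (Submodule.span ℝ {w} : Set (V → ℝ)) :=
    Submodule.closed_of_finiteDimensional _
  obtain ⟨y, hy, hxy⟩ := hclosed.exists_infDist_eq_dist ⟨0, Submodule.zero_mem _⟩ x
  obtain ⟨c, rfl⟩ := Submodule.mem_span_singleton.1 hy
  have hr := hp hpeq
  rw [hxy, dist_eq_norm] at hr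
  set r := x - c • w with hrdef
  have hs : wdot q w x = c + wdot q w r := by
    rw [hrdef, wdot_sub_right, wdot_smul_right, hw1]; ring
  set s := wdot q w x
  have hxs : x - s • w = r - wdot q w r • w := by
    rw [hs, hrdef, add_smul]; abel
  have h1 : ‖x - s • w‖ ≤ C * (ε * ‖x‖) := by
    rw [hxs]
    calc ‖r - wdot q w r • w‖ ≤ ‖r‖ + D * ‖r‖ * ‖w‖ := by
          refine (norm_sub_le _ _).trans ?_
          rw [norm_smul, Real.norm_eq_abs]
          gcongr
          exact hDx r
      _ = C * ‖r‖ := by rw [hC]; ring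
      _ ≤ _ := by gcongr
  have hx0 : 0 < ‖x‖ := norm_pos_iff.2 hp0
  have h2 : ‖x‖ ≤ 2 * (|s| * ‖w‖) := by
    have : ‖x‖ ≤ ‖x - s • w‖ + |s| * ‖w‖ := by
      rw [← Real.norm_eq_abs, ← norm_smul]
      exact norm_le_norm_sub_add _ _
    nlinarith
  have hs0 : s ≠ 0 := by
    intro h0
    rw [h0, abs_zero] at h2
    linarith
  refine ⟨hs0, ?_⟩
  have h3 : s⁻¹ • x - w = s⁻¹ • (x - s • w) := by
    rw [smul_sub, inv_smul_smul₀ hs0]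
  have hs1 : 0 < |s| := abs_pos.2 hs0
  rw [h3, norm_smul, norm_inv, Real.norm_eq_abs, inv_mul_lt_iff₀ hs1]
  calc ‖x - s • w‖ ≤ C * (ε * (2 * (|s| * ‖w‖))) := h1.trans (by gcongr)
    _ = |s| * (ε * (2 * C * ‖w‖)) := by ring
    _ < |s| * η := by
      gcongr
      nlinarith

/-- The equilibrium equation in the blown-up coordinates `x = s (w + e)`, together with the
parameter `s` and the normalization of `e`. -/
def blowup (S : ℝ → ℝ) (d : ℝ) (M : Matrix V V ℝ) (q w : V → ℝ) (z : ℝ × ℝ × (V → ℝ)) :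
    ℝ × ℝ × (V → ℝ) :=
  (z.1, wdot q w z.2.2, fun i => -d * (w i + z.2.2 i) +
    z.2.1 * (M.mulVec (w + z.2.2) i * gain S (z.1 * M.mulVec (w + z.2.2) i)))

lemma contDiff_blowup (hS : IsSaturating S) : ContDiff ℝ 1 (blowup S d M q w) := by
  have hg := hS.contDiff_gain
  have hM : ∀ i, ContDiff ℝ 1 fun z : ℝ × ℝ × (V → ℝ) => M.mulVec (w + z.2.2) i := by
    intro i
    unfold Matrix.mulVec dotProduct
    simp only [Pi.add_apply]
    fun_prop
  unfold blowup
  refine contDiff_fst.prodMk (ContDiff.prodMk ?_ (contDiff_pi.2 fun i => ?_))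
  · unfold wdot
    fun_prop
  · have h1 : ContDiff ℝ 1 fun z : ℝ × ℝ × (V → ℝ) => gain S (z.1 * M.mulVec (w + z.2.2) i) :=
      hg.comp (contDiff_fst.mul (hM i))
    have h2 := hM i
    fun_prop

/-- For `s ≠ 0` the zeros of the last component are exactly the equilibria `s (w + e)`: division by
`s` has removed the trivial branch. -/
lemma smul_blowup (hS : IsSaturating S) (s u : ℝ) (e : V → ℝ) :
    s • (blowup S d M q w (s, u, e)).2.2 = satField S d M u (s • (w + e)) := by
  funext i
  simp only [blowup, satField, Pi.smul_apply, smul_eq_mul, Matrix.mulVec_smul, Pi.add_apply]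
  rw [← hS.mul_gain (s * M.mulVec (w + e) i)]
  ring

lemma blowup_base (hμ : 0 < μ) (hw : M.mulVec w = μ • w) :
    blowup S d M q w (0, d / μ, 0) = 0 := by
  unfold blowup
  simp only [wdot_zero_right, add_zero, Pi.zero_apply, hw, zero_mul, gain_zero, mul_one,
    Pi.smul_apply, smul_eq_mul]
  refine Prod.ext rfl (Prod.ext rfl (funext fun i => ?_))
  simp only [Prod.snd_zero, Pi.zero_apply]
  field_simp
  ring

/-- The gain is flat at `0`, so `s` does not enter the last component to first order. The
directional derivatives identify the Fréchet derivative, which exists by `contDiff_blowup`. -/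
lemma hasDerivAt_blowup_line (hS : IsSaturating S) (hw : M.mulVec w = μ • w) (u₀ : ℝ)
    (v : ℝ × ℝ × (V → ℝ)) :
    HasDerivAt (fun t : ℝ => blowup S d M q w ((0, u₀, 0) + t • v))
      (v.1, wdot q w v.2.2,
        (-d) • v.2.2 + (v.2.1 * μ) • w + u₀ • M.mulVec v.2.2) 0 := by
  obtain ⟨σ, ν, η⟩ := v
  have hlin : ∀ a b : ℝ, HasDerivAt (fun t : ℝ => a + t * b) b 0 := fun a b => by
    simpa using ((hasDerivAt_id' (0 : ℝ)).mul_const b).const_add a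
  have e : (fun t : ℝ => blowup S d M q w ((0, u₀, 0) + t • (σ, ν, η))) = fun t : ℝ =>
      (0 + t * σ, 0 + t * wdot q w η, fun i => -d * (w i + t * η i) + (u₀ + t * ν) *
        ((μ * w i + t * M.mulVec η i) * gain S (t * σ * (μ * w i + t * M.mulVec η i)))) := by
    funext t
    simp [blowup, wdot_smul_right, Matrix.mulVec_add, Matrix.mulVec_smul, hw]
  rw [e]
  refine (hlin 0 σ).prodMk ((hlin 0 _).prodMk (hasDerivAt_pi.2 fun i => ?_))
  have hg : HasDerivAt (fun t : ℝ => gain S (t * σ * (μ * w i + t * M.mulVec η i))) 0 0 := by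
    have h1 : HasDerivAt (fun t : ℝ => t * σ * (μ * w i + t * M.mulVec η i))
        (1 * σ * (μ * w i + 0 * M.mulVec η i) + 0 * σ * M.mulVec η i) 0 :=
      ((hasDerivAt_id' (0 : ℝ)).mul_const σ).mul (hlin _ _)
    have h2 : HasDerivAt (gain S) 0 (0 * σ * (μ * w i + 0 * M.mulVec η i)) := by
      simpa using hS.hasDerivAt_gain_zero
    exact (h2.comp (0 : ℝ) h1).congr_deriv (zero_mul _)
  have h := ((hlin (w i) (η i)).const_mul (-d)).add
    ((hlin u₀ ν).mul ((hlin (μ * w i) (M.mulVec η i)).mul hg))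
  refine h.congr_deriv ?_
  simp only [Pi.add_apply, Pi.mul_apply, Pi.smul_apply, smul_eq_mul, zero_mul, gain_zero]
  ring

/-- Pairing the last component of a kernel vector with `w`, an adjoint eigenvector, leaves `ν μ =
0`. Then `η` is an eigenvector, so a multiple of `w`, and the normalization `⟨w, η⟩ = 0` makes it
vanish. -/
lemma exists_equiv_hasFDerivAt_blowup (hS : IsSaturating S) (h : IsDominantEigenvalue M q μ)
    (hd : 0 < d) (hw1 : wdot q w w = 1) (hw : M.mulVec w = μ • w)
    (hsimple : ∀ x, M.mulVec x = μ • x → ∃ c : ℝ, c • w = x) :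
    ∃ f' : (ℝ × ℝ × (V → ℝ)) ≃L[ℝ] (ℝ × ℝ × (V → ℝ)),
      HasFDerivAt (blowup S d M q w) (f' : _ →L[ℝ] _) (0, d / μ, 0) := by
  have hdiff : HasFDerivAt (blowup S d M q w) (fderiv ℝ (blowup S d M q w) (0, d / μ, 0))
      (0, d / μ, 0) :=
    ((contDiff_blowup hS).differentiable (by norm_num) _).hasFDerivAt
  set L := fderiv ℝ (blowup S d M q w) (0, d / μ, 0)
  have hL : ∀ v, L v = (v.1, wdot q w v.2.2,
      (-d) • v.2.2 + (v.2.1 * μ) • w + (d / μ) • M.mulVec v.2.2) := by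
    intro v
    have h1 : HasDerivAt (fun t : ℝ => ((0, d / μ, 0) : ℝ × ℝ × (V → ℝ)) + t • v) v 0 := by
      simpa using ((hasDerivAt_id' (0 : ℝ)).smul_const v).const_add
        ((0, d / μ, 0) : ℝ × ℝ × (V → ℝ))
    have h2 : HasFDerivAt (blowup S d M q w) L
        (((0, d / μ, 0) : ℝ × ℝ × (V → ℝ)) + (0 : ℝ) • v) := by simpa using hdiff
    exact (h2.comp_hasDerivAt (0 : ℝ) h1).unique (hasDerivAt_blowup_line hS hw (d / μ) v)
  have hinj : Function.Injective (L : (ℝ × ℝ × (V → ℝ)) →ₗ[ℝ] (ℝ × ℝ × (V → ℝ))) := by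
    rw [← LinearMap.ker_eq_bot, LinearMap.ker_eq_bot']
    rintro ⟨σ, ν, η⟩ hv
    have hv' := (hL (σ, ν, η)).symm.trans hv
    simp only [Prod.mk_eq_zero] at hv'
    obtain ⟨h1, h2, h3⟩ := hv'
    have h4 := congrArg (wdot q w) h3
    rw [wdot_add_right, wdot_add_right, wdot_smul_right, wdot_smul_right, wdot_smul_right,
      h.wdot_eigenvector_mulVec hw, h2, hw1, wdot_zero_right] at h4
    have hν : ν = 0 := by simpa [h.pos.ne'] using h4
    have hη : M.mulVec η = μ • η := by
      rw [hν, zero_mul, zero_smul, add_zero] at h3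
      have : (d / μ) • (M.mulVec η - μ • η) = 0 := by
        rw [smul_sub, smul_smul, div_mul_cancel₀ _ h.pos.ne', ← h3]
        module
      rw [smul_eq_zero, sub_eq_zero] at this
      exact this.resolve_left (div_pos hd h.pos).ne'
    obtain ⟨c, rfl⟩ := hsimple η hη
    rw [wdot_smul_right, hw1, mul_one] at h2
    simp [h1, hν, h2]
  refine ⟨(LinearEquiv.ofInjectiveEndo _ hinj).toContinuousLinearEquiv, ?_⟩
  convert hdiff using 1
  exact ContinuousLinearMap.ext fun _ => rfl

lemma IsDominantEigenvalue.hasBifurcationCurve [DecidableEq V] (hS : IsSaturating S)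
    (h : IsDominantEigenvalue M q μ) (hd : 0 < d) (hw1 : wdot q w w = 1)
    (hw : M.mulVec w = μ • w) (hsimple : ∀ x, M.mulVec x = μ • x → ∃ c : ℝ, c • w = x)
    {W : Submodule ℝ (V → ℝ)} (hW : ∀ x, x ∈ W ↔ M.mulVec x = μ • x) {P : (V → ℝ) → Prop}
    (hP : ∀ᶠ p : ℝ × (V → ℝ) in 𝓝 (d / μ, 0), satField S d M p.1 p.2 = 0 → p.2 ≠ 0 → P p.2) :
    HasBifurcationCurve (satField S d M) (d / μ) W P := by
  obtain ⟨f', hf'⟩ := exists_equiv_hasFDerivAt_blowup hS h hd hw1 hw hsimple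
  have hC : ContDiffAt ℝ 1 (blowup S d M q w) (0, d / μ, 0) := (contDiff_blowup hS).contDiffAt
  set Ψ := hC.toOpenPartialHomeomorph _ hf' one_ne_zero with hΨ
  have hbase : blowup S d M q w (0, d / μ, 0) = 0 := blowup_base h.pos hw
  have hsource : (0, d / μ, 0) ∈ Ψ.source :=
    hC.mem_toOpenPartialHomeomorph_source hf' one_ne_zero
  have htarget : (0 : ℝ × ℝ × (V → ℝ)) ∈ Ψ.target := by
    rw [← hbase]
    exact hC.image_mem_toOpenPartialHomeomorph_target hf' one_ne_zero
  have hsymm0 : Ψ.symm 0 = (0, d / μ, 0) := by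
    rw [← hbase]
    exact Ψ.left_inv hsource
  have hsymm : ContDiffAt ℝ 1 Ψ.symm 0 := by
    rw [← hbase]
    exact hC.to_localInverse hf' one_ne_zero
  -- The curve is the preimage of the axis `(s, 0, 0)` under the local diffeomorphism.
  set ι : ℝ → ℝ × ℝ × (V → ℝ) := fun s => (s, 0, 0) with hι
  have hιC : ContDiff ℝ 1 ι := by fun_prop
  have hι0 : ι 0 = 0 := rfl
  set c : ℝ → ℝ × ℝ × (V → ℝ) := fun s => Ψ.symm (ι s) with hc
  have hcC : ContDiffAt ℝ 1 c 0 := ContDiffAt.comp (0 : ℝ) (by rwa [hι0]) hιC.contDiffAt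
  have hc0 : c 0 = (0, d / μ, 0) := hsymm0
  set υ : ℝ → ℝ := fun s => (c s).2.1 with hυ
  set ξ : ℝ → V → ℝ := fun s => s • (w + (c s).2.2) with hξ
  have hξ0 : ξ 0 = 0 := by simp [hξ]
  have hυ0 : υ 0 = d / μ := by simp [hυ, hc0]
  have hcont : Tendsto (fun s => (υ s, ξ s)) (𝓝 0) (𝓝 (d / μ, 0)) := by
    have hcc := hcC.continuousAt
    have : ContinuousAt (fun s => (υ s, ξ s)) 0 := by
      simp only [hυ, hξ]
      fun_prop
    have := this.tendsto
    rwa [hξ0, hυ0] at this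
  have hnear := hcont.eventually
    (eventually_lt_and_of_equilibrium hS h hd hW hP one_pos)
  have hinv : ∀ s, ι s ∈ Ψ.target → blowup S d M q w (c s) = ι s := fun s hs => Ψ.right_inv hs
  have hmem : ∀ᶠ s in 𝓝 (0 : ℝ), ι s ∈ Ψ.target :=
    hιC.continuous.continuousAt.eventually (Ψ.open_target.mem_nhds htarget)
  have hCev := hcC.eventually (by simp)
  obtain ⟨ε, hε, hball⟩ := Metric.eventually_nhds_iff.1 (hnear.and (hmem.and hCev))
  have hmemball : ∀ s ∈ Set.Ioo (-ε) ε, dist s 0 < ε := fun s hs => by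
    rw [Real.dist_eq, sub_zero]
    exact abs_lt.2 hs
  refine ⟨ε, hε, ξ, υ, w, (hW w).2 hw, ?_, ?_, ?_, hξ0, hυ0, ?_, ?_, ?_⟩
  · rintro rfl
    simp [wdot] at hw1
  · intro s hs
    have := (hball (hmemball s hs)).2.2
    exact (contDiffAt_id.smul (contDiffAt_const.add this.snd.snd)).contDiffWithinAt
  · intro s hs
    have := (hball (hmemball s hs)).2.2
    exact this.snd.fst.contDiffWithinAt
  · have hd1 : HasDerivAt c (deriv c 0) 0 :=
      (hcC.differentiableAt (by norm_num)).hasDerivAt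
    have := (hasDerivAt_id' (0 : ℝ)).smul (hd1.snd.snd.const_add w)
    exact this.congr_deriv (by simp [hc0])
  · intro s hs hs0
    obtain ⟨h1, h2, -⟩ := hball (hmemball s hs)
    have h3 := hinv s h2
    have hcs : c s = (s, υ s, (c s).2.2) := by
      have : (c s).1 = s := congrArg Prod.fst h3
      exact Prod.ext this rfl
    have hξeq : satField S d M (υ s) (ξ s) = 0 := by
      rw [hξ, ← smul_blowup (q := q) hS, ← hcs, h3]
      simp [hι]
    have hξne : ξ s ≠ 0 := by
      intro h0
      have h4 := congrArg (wdot q w) h0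
      have h5 : wdot q w (c s).2.2 = 0 := congrArg (fun z => z.2.1) h3
      simp only [hξ] at h4
      rw [wdot_smul_right, wdot_add_right, hw1, h5, wdot_zero_right] at h4
      simp [hs0] at h4
    obtain ⟨h4, h5, -⟩ := h1 hξeq hξne
    exact ⟨h4, hξne, hξeq, h5⟩
  -- Conversely, a small equilibrium `x` has coordinates `s = ⟨w, x⟩` and `e = x / s - w`.
  -- Near-parallelism to `w` puts them in the chart, where they map to `(s, 0, 0)`.
  · obtain ⟨η, hη, hηball⟩ := Metric.mem_nhds_iff.1 (Ψ.open_source.mem_nhds hsource)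
    have hu : ∀ᶠ p : ℝ × (V → ℝ) in 𝓝 (d / μ, 0), dist p.1 (d / μ) < η :=
      continuousAt_fst.eventually (Metric.ball_mem_nhds _ hη)
    have hs : ∀ᶠ p : ℝ × (V → ℝ) in 𝓝 (d / μ, 0), |wdot q w p.2| < min ε η := by
      have : Continuous fun p : ℝ × (V → ℝ) => |wdot q w p.2| := by
        unfold wdot
        fun_prop
      refine this.continuousAt.eventually (gt_mem_nhds ?_)
      simpa [wdot_zero_right] using lt_min hε hη
    filter_upwards [eventually_norm_inv_smul_sub_lt hS h hd hw1 hw hsimple hη, hu, hs]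
      with p hp hup hsp hpeq hp0
    obtain ⟨u, x⟩ := p
    obtain ⟨hs0, he⟩ := hp hpeq hp0
    simp only at *
    set s := wdot q w x
    set e := s⁻¹ • x - w with hedef
    have hxe : s • (w + e) = x := by
      rw [hedef, add_sub_cancel, smul_inv_smul₀ hs0]
    have hmemsource : (s, u, e) ∈ Ψ.source := by
      apply hηball
      rw [Metric.mem_ball, Prod.dist_eq, Prod.dist_eq, max_lt_iff, max_lt_iff, Real.dist_eq,
        sub_zero, dist_zero_right]
      exact ⟨hsp.trans_le (min_le_right _ _), hup, he⟩
    have hval : blowup S d M q w (s, u, e) = ι s := by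
      refine Prod.ext rfl (Prod.ext ?_ ?_)
      · change wdot q w e = 0
        rw [hedef, wdot_sub_right, wdot_smul_right, hw1, inv_mul_cancel₀ hs0, sub_self]
      · have := smul_blowup (d := d) (M := M) (q := q) (w := w) hS s u e
        rw [hxe, hpeq] at this
        exact (smul_eq_zero.1 this).resolve_left hs0
    have hcs : c s = (s, u, e) := by
      simp only [hc]
      rw [← hval]
      exact Ψ.left_inv hmemsource
    refine ⟨s, abs_lt.1 (hsp.trans_le (min_le_left _ _)), Prod.ext ?_ ?_⟩
    · simp [hυ, hcs]
    · simp only [hξ, hcs]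
      exact hxe.symm

/-- If the small equilibria form a bifurcation curve, they exist for all parameter values slightly
above the bifurcation value. -/
lemma HasBifurcationCurve.eventually_exists {E : Type*} [NormedAddCommGroup E] [NormedSpace ℝ E]
    {F : ℝ → E → E} {u₀ : ℝ} {W : Submodule ℝ E} {P : E → Prop}
    (h : HasBifurcationCurve F u₀ W P) {r : ℝ} (hr : 0 < r) :
    ∀ᶠ u in 𝓝[>] u₀, ∃ x, (x ≠ 0 ∧ F u x = 0) ∧ ‖x‖ < r := by
  obtain ⟨ε, hε, ξ, υ, v, -, -, -, hυ, hξ0, hυ0, hξ', hbr, -⟩ := h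
  have hsmall : ∀ᶠ s in 𝓝 (0 : ℝ), ‖ξ s‖ < r := by
    refine hξ'.continuousAt.norm.eventually (gt_mem_nhds ?_)
    simpa [hξ0] using hr
  obtain ⟨δ, hδ, hball⟩ := Metric.eventually_nhds_iff.1 hsmall
  set s₁ := min (δ / 2) (ε / 2)
  have hs₁ : 0 < s₁ := lt_min (by linarith) (by linarith)
  have hs₁δ : s₁ ≤ δ / 2 := min_le_left _ _
  have hs₁ε : s₁ ≤ ε / 2 := min_le_right _ _
  have hs₁υ : u₀ < υ s₁ := (hbr s₁ ⟨by linarith, by linarith⟩ hs₁.ne').1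
  filter_upwards [Ioo_mem_nhdsGT hs₁υ] with u hu
  have hcont : ContinuousOn υ (Set.Icc 0 s₁) :=
    hυ.continuousOn.mono fun s hs => ⟨by linarith [hs.1], by linarith [hs.2]⟩
  obtain ⟨s, hs, rfl⟩ := intermediate_value_Icc hs₁.le hcont
    (show u ∈ Set.Icc (υ 0) (υ s₁) by rw [hυ0]; exact ⟨hu.1.le, hu.2.le⟩)
  have hs0 : s ≠ 0 := by
    rintro rfl
    rw [hυ0] at hu
    exact lt_irrefl _ hu.1
  obtain ⟨-, h1, h2, -⟩ := hbr s ⟨by linarith [hs.1], by linarith [hs.2]⟩ hs0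
  refine ⟨ξ s, ⟨h1, h2⟩, hball ?_⟩
  rw [Real.dist_eq, sub_zero, abs_of_nonneg hs.1]
  linarith [hs.2]

end Curve

/-! ### The energy and its minimizers for symmetric couplings. -/

lemma pos_of_mul_deriv_pos {g g' : ℝ → ℝ} (h0 : g 0 = 0) (hg : ∀ z, HasDerivAt g (g' z) z)
    (h : ∀ z, z ≠ 0 → 0 < z * g' z) {z : ℝ} (hz : z ≠ 0) : 0 < g z := by
  have hc : Continuous g := continuous_iff_continuousAt.2 fun z => (hg z).continuousAt
  rcases lt_or_gt_of_ne hz with hneg | hpos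
  · obtain ⟨c, hcm, hceq⟩ := exists_hasDerivAt_eq_slope g g' hneg hc.continuousOn
      fun x _ => hg x
    have h1 := h c hcm.2.ne
    have h2 : g' c < 0 := by nlinarith [hcm.2]
    rw [hceq, h0, zero_sub, zero_sub, neg_div_neg_eq] at h2
    by_contra! hcon
    linarith [div_nonneg_of_nonpos hcon hneg.le]
  · obtain ⟨c, hcm, hceq⟩ := exists_hasDerivAt_eq_slope g g' hpos hc.continuousOn
      fun x _ => hg x
    have h1 := h c hcm.1.ne'
    have h2 : 0 < g' c := pos_of_mul_pos_right h1 hcm.1.le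
    rw [hceq, h0, sub_zero, sub_zero] at h2
    by_contra! hcon
    linarith [div_nonpos_of_nonpos_of_nonneg hcon hpos.le]

/-- The Legendre-type potential `z S z - ∫₀ᶻ S` with derivative `z S' z`. -/
def satPotential (S : ℝ → ℝ) (z : ℝ) : ℝ := z * S z - ∫ t in (0 : ℝ)..z, S t

namespace IsSaturating

variable {S : ℝ → ℝ}

lemma hasDerivAt_satPotential (hS : IsSaturating S) (z : ℝ) :
    HasDerivAt (satPotential S) (z * deriv S z) z := by
  have h1 : HasDerivAt (fun z => ∫ t in (0 : ℝ)..z, S t) (S z) z :=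
    intervalIntegral.integral_hasDerivAt_right (hS.continuous.intervalIntegrable _ _)
      (hS.continuous.stronglyMeasurableAtFilter _ _) hS.continuous.continuousAt
  refine (((hasDerivAt_id' z).mul (hS.hasDerivAt z)).sub h1).congr_deriv ?_
  ring

lemma satPotential_zero (S : ℝ → ℝ) : satPotential S 0 = 0 := by simp [satPotential]

lemma continuous_satPotential (hS : IsSaturating S) : Continuous (satPotential S) :=
  continuous_iff_continuousAt.2 fun z => (hS.hasDerivAt_satPotential z).continuousAt

lemma deriv_lt_one_of_ne (hS : IsSaturating S) {z : ℝ} (hz : z ≠ 0) : deriv S z < 1 := by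
  rcases lt_or_gt_of_ne hz with h | h
  · rw [← hS.deriv_neg]
    exact hS.deriv_lt_one (by linarith)
  · exact hS.deriv_lt_one h

lemma satPotential_le (hS : IsSaturating S) (z : ℝ) : satPotential S z ≤ z ^ 2 / 2 := by
  by_cases hz : z = 0
  · simp [hz, satPotential_zero]
  · have := pos_of_mul_deriv_pos (g := fun z => z ^ 2 / 2 - satPotential S z)
      (g' := fun z => z - z * deriv S z) (by simp [satPotential_zero]) (fun z => by
        refine (((hasDerivAt_pow 2 z).div_const 2).sub (hS.hasDerivAt_satPotential z)).congr_deriv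
          ?_
        norm_num) (fun z hz => by
        have h1 := hS.deriv_lt_one_of_ne hz
        have h2 : z * (z - z * deriv S z) = z ^ 2 * (1 - deriv S z) := by ring
        rw [h2]
        have : 0 < 1 - deriv S z := by linarith
        positivity) hz
    linarith

/-- Compare derivatives: `S' z * S z` against `S' z * z`. This bound makes the energy positive at
the critical parameter; the bound `z² / 2` from above makes it negative along the eigenvector beyond
it. -/
lemma sq_lt_satPotential (hS : IsSaturating S) {z : ℝ} (hz : z ≠ 0) :
    S z * S z / 2 < satPotential S z := by
  have := pos_of_mul_deriv_pos (g := fun z => satPotential S z - S z * S z / 2)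
    (g' := fun z => z * deriv S z - deriv S z * S z) (by simp [satPotential_zero, hS.map_zero])
    (fun z => by
      refine ((hS.hasDerivAt_satPotential z).sub
        (((hS.hasDerivAt z).mul (hS.hasDerivAt z)).div_const 2)).congr_deriv ?_
      ring) (fun z hz => by
      have h1 := hS.deriv_pos z
      have h2 : z * (z * deriv S z - deriv S z * S z) = deriv S z * (z ^ 2 - S z * z) := by ring
      rw [h2]
      refine mul_pos h1 ?_
      rcases lt_or_gt_of_ne hz with h | h
      · have h3 := hS.lt_self (z := -z) (by linarith)
        rw [hS.odd] at h3
        nlinarith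
      · nlinarith [hS.lt_self h]) hz
  linarith

end IsSaturating

section Variational

variable {V : Type*} [Fintype V] {S : ℝ → ℝ} {d u μ : ℝ} {M : Matrix V V ℝ}

/-- An energy whose critical points `y` are the solutions of `y = k M S(y)`, for symmetric `M`. -/
def satEnergy (S : ℝ → ℝ) (M : Matrix V V ℝ) (k : ℝ) (y : V → ℝ) : ℝ :=
  ∑ i, satPotential S (y i) - k / 2 * wdot 1 (S ∘ y) (M.mulVec (S ∘ y))

lemma continuous_satEnergy (hS : IsSaturating S) :
    Continuous fun p : ℝ × (V → ℝ) => satEnergy S M p.1 p.2 := by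
  have h1 := hS.continuous
  have h2 := hS.continuous_satPotential
  unfold satEnergy wdot Matrix.mulVec dotProduct
  simp only [Function.comp_apply]
  fun_prop

/-- By symmetry both halves of the quadratic term have the same derivative. The factor `S' (y i)` is
positive, so critical points are precisely the solutions of `y = k M S(y)`. -/
lemma hasDerivAt_satEnergy_line (hS : IsSaturating S)
    (hsym : ∀ x y, wdot 1 x (M.mulVec y) = wdot 1 y (M.mulVec x)) (k : ℝ) (y v : V → ℝ) :
    HasDerivAt (fun t : ℝ => satEnergy S M k (y + t • v))
      (∑ i, deriv S (y i) * v i * (y i - k * M.mulVec (S ∘ y) i)) 0 := by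
  have hlin : ∀ i, HasDerivAt (fun t : ℝ => (y + t • v) i) (v i) 0 := fun i => by
    simpa using ((hasDerivAt_id' (0 : ℝ)).mul_const (v i)).const_add (y i)
  have hy0 : ∀ i, (y + (0 : ℝ) • v) i = y i := by simp
  set s' : V → ℝ := fun i => deriv S (y i) * v i with hs'
  have hs : ∀ i, HasDerivAt (fun t : ℝ => (S ∘ (y + t • v)) i) (s' i) 0 := fun i =>
    HasDerivAt.comp (0 : ℝ) (by rw [hy0]; exact hS.hasDerivAt _) (hlin i)
  have hMs : ∀ i, HasDerivAt (fun t : ℝ => M.mulVec (S ∘ (y + t • v)) i) (M.mulVec s' i) 0 :=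
    fun i => HasDerivAt.fun_sum fun j _ => (hs j).const_mul (M i j)
  have hw : HasDerivAt (fun t : ℝ => wdot 1 (S ∘ (y + t • v)) (M.mulVec (S ∘ (y + t • v))))
      (wdot 1 s' (M.mulVec (S ∘ y)) + wdot 1 (S ∘ y) (M.mulVec s')) 0 := by
    refine (HasDerivAt.fun_sum (u := Finset.univ) fun i _ =>
      (((hs i).mul (hMs i)).const_mul ((1 : V → ℝ) i))).congr_deriv ?_
    simp [wdot, mul_add, Finset.sum_add_distrib]
  have hp : HasDerivAt (fun t : ℝ => ∑ i, satPotential S ((y + t • v) i))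
      (∑ i, y i * deriv S (y i) * v i) 0 := by
    refine HasDerivAt.fun_sum fun i _ => ?_
    exact HasDerivAt.comp (0 : ℝ) (by rw [hy0]; exact hS.hasDerivAt_satPotential _) (hlin i)
  refine (hp.sub (hw.const_mul (k / 2))).congr_deriv ?_
  rw [hsym (S ∘ y) s']
  have : k / 2 * (wdot 1 s' (M.mulVec (S ∘ y)) + wdot 1 s' (M.mulVec (S ∘ y))) =
      ∑ i, k * (s' i * M.mulVec (S ∘ y) i) := by
    rw [← Finset.mul_sum]
    simp only [wdot, Pi.one_apply, one_mul]
    ring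
  rw [this, ← Finset.sum_sub_distrib]
  refine Finset.sum_congr rfl fun i _ => ?_
  rw [hs']
  ring

lemma satEnergy_pos (hS : IsSaturating S) (h : IsDominantEigenvalue M 1 μ) {y : V → ℝ}
    (hy : y ≠ 0) : 0 < satEnergy S M (1 / μ) y := by
  have h1 : wdot 1 (S ∘ y) (S ∘ y) / 2 < ∑ i, satPotential S (y i) := by
    obtain ⟨i, hi⟩ := Function.ne_iff.1 hy
    rw [wdot, Finset.sum_div]
    refine Finset.sum_lt_sum (fun j _ => ?_) ⟨i, Finset.mem_univ i, ?_⟩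
    · by_cases hj : y j = 0
      · simp [hj, hS.map_zero, IsSaturating.satPotential_zero]
      · simpa using (hS.sq_lt_satPotential hj).le
    · simpa using hS.sq_lt_satPotential hi
  have h2 : 1 / μ / 2 * wdot 1 (S ∘ y) (M.mulVec (S ∘ y)) ≤ wdot 1 (S ∘ y) (S ∘ y) / 2 := by
    have hμ := h.pos
    calc _ ≤ 1 / μ / 2 * (μ * wdot 1 (S ∘ y) (S ∘ y)) := by
          gcongr
          exact h.wdot_mulVec_le _
      _ = _ := by field_simp
  unfold satEnergy
  linarith

/-- Write `S(t w) = t σ(t)` with `σ(0) = w`: the quadratic term is about `k μ t² / 2`, which exceeds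
the potential's bound `t² / 2`. -/
lemma eventually_satEnergy_smul_neg (hS : IsSaturating S) {w : V → ℝ} (hw1 : wdot 1 w w = 1)
    (hw : M.mulVec w = μ • w) {k : ℝ} (hk : 0 < k) (hkμ : 1 < k * μ) :
    ∀ᶠ t : ℝ in 𝓝[>] 0, satEnergy S M k (t • w) < 0 := by
  set σ : ℝ → V → ℝ := fun t i => w i * gain S (t * w i) with hσ
  have hσ0 : σ 0 = w := by
    funext i
    simp [hσ, gain_zero]
  have hσc : Continuous fun t => wdot 1 (σ t) (M.mulVec (σ t)) := by
    have := hS.contDiff_gain.continuous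
    unfold wdot Matrix.mulVec dotProduct
    simp only [hσ]
    fun_prop
  have hlt : ∀ᶠ t in 𝓝 (0 : ℝ), 1 / k < wdot 1 (σ t) (M.mulVec (σ t)) := by
    refine hσc.continuousAt.eventually (lt_mem_nhds ?_)
    beta_reduce
    rw [hσ0, hw, wdot_smul_right, hw1, mul_one, div_lt_iff₀ hk]
    linarith
  filter_upwards [hlt.filter_mono nhdsWithin_le_nhds, eventually_mem_nhdsWithin] with t ht ht0
  have ht0 : 0 < t := ht0
  have hs : S ∘ (t • w) = t • σ t := by
    funext i
    simp only [hσ, Function.comp_apply, Pi.smul_apply, smul_eq_mul]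
    rw [← hS.mul_gain]
    ring
  have h1 : ∑ i, satPotential S ((t • w) i) ≤ t ^ 2 / 2 := by
    calc _ ≤ ∑ i, t ^ 2 / 2 * ((1 : V → ℝ) i * (w i * w i)) :=
          Finset.sum_le_sum fun i _ => (hS.satPotential_le _).trans (le_of_eq (by
            simp only [Pi.smul_apply, smul_eq_mul, Pi.one_apply]; ring))
      _ = t ^ 2 / 2 := by
        rw [← Finset.mul_sum, ← wdot, hw1, mul_one]
  unfold satEnergy
  rw [hs, Matrix.mulVec_smul, wdot_smul_left, wdot_smul_right]
  rw [div_lt_iff₀ hk] at ht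
  nlinarith [sq_pos_of_pos ht0]

/-- Beyond the bifurcation value, a symmetric coupling has small nonzero equilibria: they come from
minimizers of the energy in a small ball. -/
lemma eventually_exists_equilibrium_of_symmetric (hS : IsSaturating S)
    (h : IsDominantEigenvalue M 1 μ) (hd : 0 < d)
    (hsym : ∀ x y, wdot 1 x (M.mulVec y) = wdot 1 y (M.mulVec x)) {r : ℝ} (hr : 0 < r) :
    ∀ᶠ u in 𝓝[>] (d / μ), ∃ x, (x ≠ 0 ∧ satField S d M u x = 0) ∧ ‖x‖ < r := by
  obtain ⟨w, hw1, hw⟩ := exists_normalized_eigenvector h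
  have hμ := h.pos
  -- The equilibrium will be `x = k S(y)` with `k < 2 / μ` and `‖y‖ ≤ ρ`, so `‖x‖ ≤ r / 2`.
  set ρ := r * μ / 4 with hρ
  have hρ0 : 0 < ρ := by positivity
  -- Positivity on the sphere at `u = d / μ` persists nearby by compactness. As the minimum over the
  -- ball is negative, it is attained at a nonzero interior point.
  have hsphere : ∀ᶠ u in 𝓝 (d / μ), ∀ y ∈ Metric.sphere (0 : V → ℝ) ρ,
      0 < satEnergy S M (u / d) y := by
    refine (isCompact_sphere (0 : V → ℝ) ρ).eventually_forall_of_forall_eventually fun y hy => ?_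
    have hc : Continuous fun p : ℝ × (V → ℝ) => satEnergy S M (p.1 / d) p.2 :=
      (continuous_satEnergy hS).comp ((continuous_fst.div_const d).prodMk continuous_snd)
    refine hc.continuousAt.eventually (lt_mem_nhds ?_)
    have : d / μ / d = 1 / μ := by field_simp
    simp only [this]
    refine satEnergy_pos hS h ?_
    rintro rfl
    simp [hρ0.ne] at hy
  have hupper : ∀ᶠ u in 𝓝 (d / μ), u < 2 * (d / μ) :=
    gt_mem_nhds (by have : 0 < d / μ := by positivity
                    linarith)
  filter_upwards [hsphere.filter_mono nhdsWithin_le_nhds, hupper.filter_mono nhdsWithin_le_nhds,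
    eventually_mem_nhdsWithin] with u hus huu hul
  have hul : d / μ < u := hul
  have hu0 : 0 < u := (div_pos hd hμ).trans hul
  set k := u / d with hk
  have hk0 : 0 < k := by positivity
  have hkμ : 1 < k * μ := by
    rw [div_lt_iff₀ hμ] at hul
    rw [hk, div_mul_eq_mul_div, lt_div_iff₀ hd]
    linarith
  have hk2 : k < 2 / μ := by
    rw [hk, div_lt_iff₀ hd]
    calc u < 2 * (d / μ) := huu
      _ = _ := by ring
  have hcont : Continuous (satEnergy S M k) :=
    (continuous_satEnergy hS).comp (Continuous.prodMk_right k)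
  obtain ⟨y, hy, hmin⟩ := (isCompact_closedBall (0 : V → ℝ) ρ).exists_isMinOn
    ⟨0, Metric.mem_closedBall_self hρ0.le⟩ hcont.continuousOn
  have hneg : satEnergy S M k y < 0 := by
    have hsmall : ∀ᶠ t : ℝ in 𝓝[>] 0, t • w ∈ Metric.closedBall (0 : V → ℝ) ρ := by
      have : Tendsto (fun t : ℝ => t • w) (𝓝[>] 0) (𝓝 0) := by
        have h0 : Continuous fun t : ℝ => t • w := by fun_prop
        have := h0.tendsto 0
        rw [zero_smul] at this
        exact this.mono_left nhdsWithin_le_nhds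
      exact this.eventually (Metric.closedBall_mem_nhds _ hρ0)
    obtain ⟨t, ht1, ht2⟩ :=
      (hsmall.and (eventually_satEnergy_smul_neg hS hw1 hw hk0 hkμ)).exists
    exact (hmin ht1).trans_lt ht2
  have hyball : y ∈ Metric.ball (0 : V → ℝ) ρ := by
    rw [Metric.mem_closedBall] at hy
    refine Metric.mem_ball.2 (lt_of_le_of_ne hy fun he => ?_)
    linarith [hus y (Metric.mem_sphere.2 he)]
  have hy0 : y ≠ 0 := by
    rintro rfl
    simp [satEnergy, IsSaturating.satPotential_zero, Function.comp_def, hS.map_zero, wdot]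
      at hneg
  -- In this direction the derivative of the energy is `∑ S' (y i) * v i ^ 2`, so its vanishing
  -- forces `v = 0`.
  set v : V → ℝ := fun i => y i - k * M.mulVec (S ∘ y) i with hv
  have hder := hasDerivAt_satEnergy_line hS hsym k y v
  have hlocal : IsLocalMin (fun t : ℝ => satEnergy S M k (y + t • v)) 0 := by
    have hc : Continuous fun t : ℝ => y + t • v := by fun_prop
    have hev : ∀ᶠ t in 𝓝 (0 : ℝ), y + t • v ∈ Metric.ball (0 : V → ℝ) ρ := by
      refine hc.continuousAt.eventually (Metric.isOpen_ball.mem_nhds ?_)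
      simpa using hyball
    filter_upwards [hev] with t ht
    have := hmin (Metric.ball_subset_closedBall ht)
    simpa using this
  have hzero := hlocal.hasDerivAt_eq_zero hder
  have hcrit : ∀ i, y i = k * M.mulVec (S ∘ y) i := by
    have hnn : ∀ i ∈ Finset.univ,
        0 ≤ deriv S (y i) * v i * (y i - k * M.mulVec (S ∘ y) i) := fun i _ => by
      have e : deriv S (y i) * v i * (y i - k * M.mulVec (S ∘ y) i) =
          deriv S (y i) * v i ^ 2 := by rw [hv]; ring
      rw [e]
      exact mul_nonneg (hS.deriv_pos _).le (sq_nonneg _)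
    rw [Finset.sum_eq_zero_iff_of_nonneg hnn] at hzero
    intro i
    have h1 := hzero i (Finset.mem_univ i)
    have h2 : deriv S (y i) * v i ^ 2 = 0 := by
      rw [← h1, hv]; ring
    have h3 := (mul_eq_zero.1 h2).resolve_left (hS.deriv_pos _).ne'
    have h4 : v i = 0 := by simpa using h3
    simp only [hv] at h4
    linarith
  have hMx : M.mulVec (k • (S ∘ y)) = y := by
    funext i
    rw [Matrix.mulVec_smul, hcrit i]
    rfl
  refine ⟨k • (S ∘ y), ⟨?_, ?_⟩, ?_⟩
  · intro h0
    rw [h0, Matrix.mulVec_zero] at hMx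
    exact hy0 hMx.symm
  · rw [satField_eq_zero_iff, hMx]
    intro i
    simp only [Pi.smul_apply, smul_eq_mul, Function.comp_apply, hk]
    field_simp
  · have hSy : ‖S ∘ y‖ ≤ ρ := by
      rw [pi_norm_le_iff_of_nonneg hρ0.le]
      intro i
      exact (hS.abs_le_abs _).trans ((norm_le_pi_norm y i).trans (by simpa using hy))
    rw [norm_smul, Real.norm_eq_abs, abs_of_pos hk0]
    calc k * ‖S ∘ y‖ ≤ 2 / μ * ρ := by gcongr
      _ = r / 2 := by rw [hρ]; field_simp; norm_num
      _ < r := by linarith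

end Variational

/-! ### Perron–Frobenius theory of irreducible nonnegative matrices. -/

section PerronFrobenius

variable {V : Type*} [Fintype V] {A : Matrix V V ℝ} {r : ℝ} {w p : V → ℝ}

lemma mul_le_mulVec (hA : ∀ i j, 0 ≤ A i j) {x : V → ℝ} (hx : ∀ i, 0 ≤ x i) (i j : V) :
    A i j * x j ≤ A.mulVec x i :=
  Finset.single_le_sum (f := fun j => A i j * x j) (fun j _ => mul_nonneg (hA i j) (hx j))
    (Finset.mem_univ j)

/-- A nonnegative eigenvector of an irreducible nonnegative matrix is positive. -/
lemma eigenvector_pos (hA : ∀ i j, 0 ≤ A i j)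
    (hirr : ∀ i k, Relation.ReflTransGen (fun i j => 0 < A i j) i k) (hr : 0 ≤ r) {x : V → ℝ}
    (hx : ∀ i, 0 ≤ x i) (hx0 : x ≠ 0) (heq : A.mulVec x = r • x) (i : V) : 0 < x i := by
  obtain ⟨k, hk⟩ := Function.ne_iff.1 hx0
  have hkpos : 0 < x k := (hx k).lt_of_ne' hk
  induction hirr i k using Relation.ReflTransGen.head_induction_on with
  | refl => exact hkpos
  | @head a b hab _ ih =>
    have h1 := mul_le_mulVec hA hx a b
    rw [heq] at h1
    have h2 : 0 < r * x a := (mul_pos hab ih).trans_le h1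
    exact pos_of_mul_pos_right h2 hr

/-- A path of `n` edges makes an entry of `(1 + A) ^ n` positive, and the positive diagonal keeps it
positive in higher powers, so one exponent serves all pairs. -/
lemma exists_pow_pos [DecidableEq V] (hA : ∀ i j, 0 ≤ A i j)
    (hirr : ∀ i k, Relation.ReflTransGen (fun i j => 0 < A i j) i k) :
    ∃ n : ℕ, ∀ i k, 0 < ((1 + A) ^ n) i k := by
  have hB : ∀ i j, 0 ≤ (1 + A) i j := fun i j => by
    rw [Matrix.add_apply, Matrix.one_apply]
    have := hA i j
    split_ifs <;> linarith
  have hBd : ∀ i, 0 < (1 + A) i i := fun i => by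
    rw [Matrix.add_apply, Matrix.one_apply_eq]
    linarith [hA i i]
  have hBn : ∀ (n : ℕ) (i j : V), 0 ≤ ((1 + A) ^ n) i j := by
    intro n
    induction n with
    | zero => intro i j; rw [pow_zero, Matrix.one_apply]; split_ifs <;> norm_num
    | succ n ih =>
      intro i j
      rw [pow_succ', Matrix.mul_apply]
      exact Finset.sum_nonneg fun l _ => mul_nonneg (hB i l) (ih l j)
  have hstep : ∀ (n : ℕ) (i j k : V), 0 < (1 + A) i j → 0 < ((1 + A) ^ n) j k →
      0 < ((1 + A) ^ (n + 1)) i k := by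
    intro n i j k h1 h2
    rw [pow_succ', Matrix.mul_apply]
    exact (mul_pos h1 h2).trans_le (Finset.single_le_sum
      (f := fun l => (1 + A) i l * ((1 + A) ^ n) l k)
      (fun l _ => mul_nonneg (hB i l) (hBn n l k)) (Finset.mem_univ j))
  have hmono : ∀ (n m : ℕ) (i k : V), n ≤ m → 0 < ((1 + A) ^ n) i k → 0 < ((1 + A) ^ m) i k := by
    intro n m i k hnm h
    induction m, hnm using Nat.le_induction with
    | base => exact h
    | succ m _ ih => exact hstep m i i k (hBd i) ih
  have hex : ∀ i k, ∃ n : ℕ, 0 < ((1 + A) ^ n) i k := by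
    intro i k
    induction hirr i k using Relation.ReflTransGen.head_induction_on with
    | refl => exact ⟨0, by simp⟩
    | @head a b hab _ ih =>
      obtain ⟨n, hn⟩ := ih
      refine ⟨n + 1, hstep n a b k ?_ hn⟩
      rw [Matrix.add_apply, Matrix.one_apply]
      split_ifs <;> linarith
  choose n hn using hex
  refine ⟨∑ i, ∑ k, n i k, fun i k => hmono _ _ i k ?_ (hn i k)⟩
  calc n i k ≤ ∑ k, n i k :=
        Finset.single_le_sum (f := fun k => n i k) (fun _ _ => Nat.zero_le _) (Finset.mem_univ k)
    _ ≤ _ := Finset.single_le_sum (f := fun i => ∑ k, n i k) (fun _ _ => Nat.zero_le _)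
        (Finset.mem_univ i)

/-- The maximum of the Collatz–Wielandt function. -/
lemma exists_max_collatzWielandt [Nonempty V] (hA : ∀ i j, 0 ≤ A i j) :
    ∃ r x, 0 ≤ r ∧ x ∈ stdSimplex ℝ V ∧ (∀ i, r * x i ≤ A.mulVec x i) ∧
      ∀ r' x', x' ∈ stdSimplex ℝ V → (∀ i, r' * x' i ≤ A.mulVec x' i) → r' ≤ r := by
  classical
  set R := ∑ i, ∑ j, A i j with hR
  have hbound : ∀ r x, x ∈ stdSimplex ℝ V → (∀ i, r * x i ≤ A.mulVec x i) → r ≤ R := by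
    intro r x hx h
    calc r = ∑ i, r * x i := by rw [← Finset.mul_sum, hx.2, mul_one]
      _ ≤ ∑ i, A.mulVec x i := Finset.sum_le_sum fun i _ => h i
      _ ≤ R := by
        refine Finset.sum_le_sum fun i _ => Finset.sum_le_sum fun j _ => ?_
        have hxj : x j ≤ 1 := by
          rw [← hx.2]
          exact Finset.single_le_sum (fun i _ => hx.1 i) (Finset.mem_univ j)
        exact mul_le_of_le_one_right (hA i j) hxj
  -- The Collatz–Wielandt function need not be continuous; maximizing the coordinate `r` over this
  -- compact set of pairs avoids it.
  set T : Set (ℝ × (V → ℝ)) :=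
    (Set.Icc 0 R ×ˢ stdSimplex ℝ V) ∩ {z | ∀ i, z.1 * z.2 i ≤ A.mulVec z.2 i} with hT
  have hTc : IsCompact T := by
    refine (isCompact_Icc.prod (isCompact_stdSimplex ℝ V)).inter_right ?_
    simp only [Set.ofPred_forall]
    refine isClosed_iInter fun i => isClosed_le (by fun_prop) (by fun_prop)
  obtain ⟨i₀⟩ := ‹Nonempty V›
  have hR0 : 0 ≤ R := Finset.sum_nonneg fun i _ => Finset.sum_nonneg fun j _ => hA i j
  have hmul : ∀ x ∈ stdSimplex ℝ V, ∀ i, 0 ≤ A.mulVec x i := fun x hx i =>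
    Finset.sum_nonneg fun j _ => mul_nonneg (hA i j) (hx.1 j)
  have hTne : T.Nonempty := ⟨(0, Pi.single i₀ 1),
    ⟨⟨⟨le_rfl, hR0⟩, single_mem_stdSimplex ℝ i₀⟩, fun i => by
      simpa using hmul _ (single_mem_stdSimplex ℝ i₀) i⟩⟩
  obtain ⟨⟨r, x⟩, ⟨⟨hr, hx⟩, hrx⟩, hmax⟩ := hTc.exists_isMaxOn hTne continuousOn_fst
  refine ⟨r, x, hr.1, hx, hrx, fun r' x' hx' h' => ?_⟩
  rcases le_or_gt 0 r' with h0 | h0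
  · exact hmax (show (r', x') ∈ T from ⟨⟨⟨h0, hbound r' x' hx' h'⟩, hx'⟩, h'⟩)
  · exact h0.le.trans hr.1

/-- If the maximizer had `A x ≠ r x`, a positive power `B` of `1 + A` would make the inequality
strict everywhere at `B x`, and `r` could be raised. An edge, present as `V` is nontrivial, makes
`r` positive. -/
lemma exists_perron_eigenvector [Nontrivial V] (hA : ∀ i j, 0 ≤ A i j)
    (hirr : ∀ i k, Relation.ReflTransGen (fun i j => 0 < A i j) i k) :
    ∃ r : ℝ, 0 < r ∧ ∃ w : V → ℝ, (∀ i, 0 < w i) ∧ A.mulVec w = r • w := by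
  classical
  obtain ⟨r, x, hr, hx, hrx, hmax⟩ := exists_max_collatzWielandt hA
  have hx0 : x ≠ 0 := by
    rintro rfl
    simpa using hx.2
  have heq : A.mulVec x = r • x := by
    by_contra hne
    obtain ⟨n, hn⟩ := exists_pow_pos hA hirr
    set B := (1 + A) ^ n with hB
    have hBpos : ∀ y : V → ℝ, (∀ i, 0 ≤ y i) → y ≠ 0 → ∀ i, 0 < B.mulVec y i := by
      intro y hy hy0 i
      obtain ⟨k, hk⟩ := Function.ne_iff.1 hy0
      exact (mul_pos (hn i k) ((hy k).lt_of_ne' hk)).trans_le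
        (mul_le_mulVec (fun i j => (hn i j).le) hy i k)
    have hcomm : A * B = B * A := by
      have : Commute A B := (Commute.add_right (Commute.one_right A) (Commute.refl A)).pow_right n
      exact this
    set x' := B.mulVec x
    set z' := B.mulVec (A.mulVec x - r • x)
    have hx' : ∀ i, 0 < x' i := hBpos x hx.1 hx0
    have hz' : ∀ i, 0 < z' i := hBpos _ (fun i => by
      have := hrx i
      simp only [Pi.sub_apply, Pi.smul_apply, smul_eq_mul]
      linarith) (sub_ne_zero.2 hne)
    have hAx' : ∀ i, A.mulVec x' i = r * x' i + z' i := by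
      intro i
      have : z' = A.mulVec x' - r • x' := by
        simp only [z', x', Matrix.mulVec_sub, Matrix.mulVec_smul, Matrix.mulVec_mulVec, hcomm]
      rw [this]
      simp
    obtain ⟨i₀, hi₀⟩ := Finite.exists_min fun i => z' i / x' i
    set δ := z' i₀ / x' i₀
    have hδ : 0 < δ := div_pos (hz' i₀) (hx' i₀)
    have hsum : 0 < ∑ i, x' i := Finset.sum_pos (fun i _ => hx' i) Finset.univ_nonempty
    have hle := hmax (r + δ) ((∑ i, x' i)⁻¹ • x') ⟨fun i => by
        have := hx' i
        simp only [Pi.smul_apply, smul_eq_mul]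
        positivity, by
        simp only [Pi.smul_apply, smul_eq_mul, ← Finset.mul_sum]
        exact inv_mul_cancel₀ hsum.ne'⟩ (fun i => by
        rw [Matrix.mulVec_smul]
        simp only [Pi.smul_apply, smul_eq_mul]
        rw [mul_left_comm]
        refine mul_le_mul_of_nonneg_left ?_ (inv_pos.2 hsum).le
        rw [hAx']
        have h1 := (le_div_iff₀ (hx' i)).1 (hi₀ i)
        linarith)
    linarith
  have hpos := eigenvector_pos hA hirr hr hx.1 hx0 heq
  refine ⟨r, ?_, x, hpos, heq⟩
  obtain ⟨i, k, hik⟩ := exists_pair_ne V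
  rcases Relation.ReflTransGen.cases_head (hirr i k) with h | ⟨j, hij, -⟩
  · exact absurd h hik
  · have h1 := mul_le_mulVec hA hx.1 i j
    rw [heq] at h1
    exact pos_of_mul_pos_left ((mul_pos hij (hpos j)).trans_le h1) (hpos i).le

/-- The Perron eigenvalue is geometrically simple. -/
lemma exists_smul_eq_of_perron [Nonempty V] (hA : ∀ i j, 0 ≤ A i j)
    (hirr : ∀ i k, Relation.ReflTransGen (fun i j => 0 < A i j) i k) (hr : 0 ≤ r)
    (hw : ∀ i, 0 < w i) (hAw : A.mulVec w = r • w) {x : V → ℝ} (hx : A.mulVec x = r • x) :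
    ∃ c : ℝ, c • w = x := by
  -- For the least ratio `t`, `x - t • w` is a nonnegative eigenvector with a zero entry, so it must
  -- vanish.
  obtain ⟨i₀, hi₀⟩ := Finite.exists_min fun i => x i / w i
  set t := x i₀ / w i₀
  refine ⟨t, ?_⟩
  by_contra hne
  have hpos := eigenvector_pos hA hirr hr (x := x - t • w) (fun i => by
    have := (le_div_iff₀ (hw i)).1 (hi₀ i)
    simp only [Pi.sub_apply, Pi.smul_apply, smul_eq_mul]
    linarith) (sub_ne_zero.2 (Ne.symm hne))
    (by rw [Matrix.mulVec_sub, Matrix.mulVec_smul, hx, hAw, smul_sub, smul_comm]) i₀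
  have : (x - t • w) i₀ = 0 := by
    have := (hw i₀).ne'
    simp only [Pi.sub_apply, Pi.smul_apply, smul_eq_mul, t]
    field_simp
    ring
  linarith

/-- With right and left Perron eigenvectors `w`, `p`, the matrix is dissipative relative to the
Perron eigenvalue for the weights `p / w`. -/
lemma wdot_mulVec_le_of_perron (hA : ∀ i j, 0 ≤ A i j) (hw : ∀ i, 0 < w i) (hp : ∀ i, 0 < p i)
    (hAw : A.mulVec w = r • w) (hAp : A.transpose.mulVec p = r • p) (x : V → ℝ) :
    wdot (p / w) x (A.mulVec x) ≤ r * wdot (p / w) x x := by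
  -- With `x = w ζ` the form has coefficients `A i k * p i * w k`, whose row and column sums are `r
  -- * p i * w i` and `r * p k * w k`; then `ζ i * ζ k ≤ (ζ i ^ 2 + ζ k ^ 2) / 2` suffices.
  set ζ : V → ℝ := fun i => x i / w i with hζ
  have hx : ∀ i, x i = w i * ζ i := fun i => by
    have := (hw i).ne'
    simp only [hζ]
    field_simp
  have hrow : ∀ i, ∑ k, A i k * w k = r * w i := fun i => congrFun hAw i
  have hcol : ∀ k, ∑ i, A i k * p i = r * p k := fun k => congrFun hAp k
  have e1 : wdot (p / w) x (A.mulVec x) = ∑ i, ∑ k, A i k * (p i * w k) * (ζ i * ζ k) := by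
    refine Finset.sum_congr rfl fun i _ => ?_
    rw [Matrix.mulVec, dotProduct, Finset.mul_sum, Finset.mul_sum]
    refine Finset.sum_congr rfl fun k _ => ?_
    have := (hw i).ne'
    rw [hx i, hx k, Pi.div_apply]
    field_simp
  have e2 : ∑ i, ∑ k, A i k * (p i * w k) * (ζ i ^ 2) = r * wdot (p / w) x x := by
    rw [wdot, Finset.mul_sum]
    refine Finset.sum_congr rfl fun i _ => ?_
    have := (hw i).ne'
    calc _ = p i * ζ i ^ 2 * ∑ k, A i k * w k := by
          rw [Finset.mul_sum]
          exact Finset.sum_congr rfl fun k _ => by ring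
      _ = _ := by
          rw [hrow, hx i, Pi.div_apply]
          field_simp
  have e3 : ∑ i, ∑ k, A i k * (p i * w k) * (ζ k ^ 2) = r * wdot (p / w) x x := by
    rw [Finset.sum_comm, wdot, Finset.mul_sum]
    refine Finset.sum_congr rfl fun k _ => ?_
    have := (hw k).ne'
    calc _ = w k * ζ k ^ 2 * ∑ i, A i k * p i := by
          rw [Finset.mul_sum]
          exact Finset.sum_congr rfl fun i _ => by ring
      _ = _ := by
          rw [hcol, hx k, Pi.div_apply]
          field_simp
  have e4 : ∑ i, ∑ k, A i k * (p i * w k) * (ζ i * ζ k) ≤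
      ∑ i, ∑ k, (A i k * (p i * w k) * (ζ i ^ 2) + A i k * (p i * w k) * (ζ k ^ 2)) / 2 := by
    refine Finset.sum_le_sum fun i _ => Finset.sum_le_sum fun k _ => ?_
    have h0 : 0 ≤ A i k * (p i * w k) := mul_nonneg (hA i k) (mul_pos (hp i) (hw k)).le
    nlinarith [mul_nonneg h0 (sq_nonneg (ζ i - ζ k))]
  rw [e1]
  refine e4.trans (le_of_eq ?_)
  simp only [← Finset.sum_div, Finset.sum_add_distrib, e2, e3]
  ring

end PerronFrobenius

/-! ### Cooperation: Perron data and agreement. -/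

section Cooperation

variable {V : Type*} [Fintype V] [DecidableEq V]

lemma exists_perron_data [Nontrivial V] {A : Matrix V V ℝ} (hA : ∀ i j, 0 ≤ A i j)
    (hirr : ∀ i k, Relation.ReflTransGen (fun i j => 0 < A i j) i k) {α γ : ℝ} (hα : 0 < α)
    (hγ : 0 < γ) :
    ∃ (r : ℝ) (q w : V → ℝ),
      IsDominantEigenvalue (α • (1 : Matrix V V ℝ) + γ • A) q (α + γ * r) ∧ (∀ i, 0 < w i) ∧
      wdot q w w = 1 ∧ (α • (1 : Matrix V V ℝ) + γ • A).mulVec w = (α + γ * r) • w ∧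
      ∀ x, (α • (1 : Matrix V V ℝ) + γ • A).mulVec x = (α + γ * r) • x →
        ∃ c : ℝ, c • w = x := by
  obtain ⟨r, hr, w, hw, hAw⟩ := exists_perron_eigenvector hA hirr
  obtain ⟨r', hr', p, hp, hAp⟩ := exists_perron_eigenvector (A := A.transpose)
    (fun i j => hA j i) (fun i k => Relation.reflTransGen_swap.1 (hirr k i))
  -- Evaluating `p · A w` from both sides gives `r (p · w) = r' (p · w)`, with `p · w > 0`.
  have hrr : r' = r := by
    have h1 : dotProduct p (A.mulVec w) = dotProduct (A.transpose.mulVec p) w := by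
      rw [Matrix.dotProduct_mulVec, Matrix.mulVec_transpose]
    rw [hAw, hAp, dotProduct_smul, smul_dotProduct, smul_eq_mul, smul_eq_mul] at h1
    have h2 : 0 < dotProduct p w :=
      Finset.sum_pos (fun i _ => mul_pos (hp i) (hw i)) Finset.univ_nonempty
    exact (mul_right_cancel₀ h2.ne' h1).symm
  subst hrr
  have hq : ∀ i, 0 < (p / w) i := fun i => div_pos (hp i) (hw i)
  have hw0 : w ≠ 0 := fun h0 => by
    obtain ⟨i⟩ := (inferInstance : Nonempty V)
    exact (hw i).ne' (congrFun h0 i)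
  have hww := wdot_self_pos hq hw0
  set c := (√(wdot (p / w) w w))⁻¹ with hc
  have hc0 : 0 < c := by positivity
  have hMw : (α • (1 : Matrix V V ℝ) + γ • A).mulVec w = (α + γ * r') • w :=
    (mulVec_affine_eq_iff hγ.ne').2 hAw
  have hAcw : A.mulVec (c • w) = r' • (c • w) := by
    rw [Matrix.mulVec_smul, hAw, smul_comm]
  have hcw : ∀ i, 0 < (c • w) i := fun i => mul_pos hc0 (hw i)
  refine ⟨r', p / w, c • w, ⟨hq, by positivity, fun x => ?_, w, hw0, hMw⟩, hcw, ?_,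
    (mulVec_affine_eq_iff hγ.ne').2 hAcw, fun x hx => ?_⟩
  · rw [Matrix.add_mulVec, Matrix.smul_mulVec, Matrix.smul_mulVec, Matrix.one_mulVec,
      wdot_add_right, wdot_smul_right, wdot_smul_right]
    have := mul_le_mul_of_nonneg_left (wdot_mulVec_le_of_perron hA hw hp hAw hAp x) hγ.le
    linarith
  · rw [wdot_smul_left, wdot_smul_right, ← mul_assoc, hc, ← mul_inv, Real.mul_self_sqrt hww.le,
      inv_mul_cancel₀ hww.ne']
  · exact exists_smul_eq_of_perron hA hirr hr'.le hcw hAcw ((mulVec_affine_eq_iff hγ.ne').1 hx)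

/-- A rescaled small equilibrium is within `min w` of `w`, so its entries are positive; the scaling
factor decides the common sign. -/
lemma eventually_isAgreement [Nonempty V] {S : ℝ → ℝ} (hS : IsSaturating S) {d μ : ℝ}
    (hd : 0 < d) {M : Matrix V V ℝ} {q w : V → ℝ} (h : IsDominantEigenvalue M q μ)
    (hwpos : ∀ i, 0 < w i) (hw1 : wdot q w w = 1) (hw : M.mulVec w = μ • w)
    (hsimple : ∀ x, M.mulVec x = μ • x → ∃ c : ℝ, c • w = x) :
    ∀ᶠ p : ℝ × (V → ℝ) in 𝓝 (d / μ, 0), satField S d M p.1 p.2 = 0 → p.2 ≠ 0 →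
      IsAgreement p.2 := by
  obtain ⟨i₀, hi₀⟩ := Finite.exists_min w
  filter_upwards [eventually_norm_inv_smul_sub_lt hS h hd hw1 hw hsimple (hwpos i₀)]
    with p hp h1 h2
  obtain ⟨hs, he⟩ := hp h1 h2
  set s := wdot q w p.2
  have hpos : ∀ i, 0 < s⁻¹ * p.2 i := fun i => by
    have h3 := (norm_le_pi_norm (s⁻¹ • p.2 - w) i).trans_lt he
    rw [Real.norm_eq_abs, abs_lt] at h3
    have h4 := h3.1
    simp only [Pi.sub_apply, Pi.smul_apply, smul_eq_mul] at h4
    linarith [hi₀ i]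
  rcases lt_or_gt_of_ne hs with hneg | hspos
  · exact Or.inr fun i => neg_of_mul_pos_right (hpos i) (inv_lt_zero.2 hneg).le
  · exact Or.inl fun i => pos_of_mul_pos_right (hpos i) (inv_pos.2 hspos).le

end Cooperation

/-! ### Competition: the least Rayleigh quotient and disagreement. -/

section Competition

variable {V : Type*} [Fintype V] {A : Matrix V V ℝ}

lemma exists_min_rayleigh [Nonempty V]
    (hsym : ∀ x y, wdot 1 x (A.mulVec y) = wdot 1 y (A.mulVec x)) :
    ∃ (l : ℝ) (w : V → ℝ), w ≠ 0 ∧ A.mulVec w = l • w ∧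
      ∀ x, l * wdot 1 x x ≤ wdot 1 x (A.mulVec x) := by
  classical
  have hone : ∀ i : V, 0 < (1 : V → ℝ) i := fun _ => one_pos
  set K : Set (V → ℝ) := {x | wdot 1 x x = 1} with hK
  have hKclosed : IsClosed K := by
    refine isClosed_eq ?_ continuous_const
    unfold wdot
    fun_prop
  obtain ⟨a, ha, ha'⟩ := exists_norm_sq_le_wdot_self hone
  have hKcompact : IsCompact K := by
    refine (isCompact_closedBall (0 : V → ℝ) (a + 1)).of_isClosed_subset hKclosed fun x hx => ?_
    have h1 := ha' x
    have hx : wdot 1 x x = 1 := hx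
    rw [hx] at h1
    rw [mem_closedBall_zero_iff]
    nlinarith [norm_nonneg x]
  obtain ⟨i⟩ := ‹Nonempty V›
  have hne : K.Nonempty := ⟨Pi.single i 1, by simp [hK, wdot, Pi.single_apply]⟩
  have hcont : Continuous fun x : V → ℝ => wdot 1 x (A.mulVec x) := by
    unfold wdot Matrix.mulVec dotProduct
    fun_prop
  obtain ⟨w, hw, hmin⟩ := hKcompact.exists_isMinOn hne hcont.continuousOn
  have hw : wdot 1 w w = 1 := hw
  set l := wdot 1 w (A.mulVec w) with hl
  have hray : ∀ x, l * wdot 1 x x ≤ wdot 1 x (A.mulVec x) := by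
    intro x
    by_cases hx : x = 0
    · simp [hx, wdot]
    have hpos := wdot_self_pos hone hx
    set c := √(wdot 1 x x) with hc
    have hcc : c * c = wdot 1 x x := Real.mul_self_sqrt hpos.le
    have hc0 : 0 < c := Real.sqrt_pos.2 hpos
    have hmem : c⁻¹ • x ∈ K := by
      change wdot 1 (c⁻¹ • x) (c⁻¹ • x) = 1
      rw [wdot_smul_left, wdot_smul_right, ← hcc]
      field_simp
    have h1 : l ≤ wdot 1 (c⁻¹ • x) (A.mulVec (c⁻¹ • x)) := hmin hmem
    rw [Matrix.mulVec_smul, wdot_smul_left, wdot_smul_right, ← mul_assoc, ← mul_inv, hcc,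
      inv_mul_eq_div, le_div_iff₀ hpos] at h1
    exact h1
  refine ⟨l, w, fun h0 => by simp [h0, wdot] at hw, ?_, hray⟩
  -- Perturbing the minimizer along its own residual `z` gives the linear coefficient `-2 ⟨z, z⟩`,
  -- which must vanish.
  set z := A.mulVec w - l • w with hz
  have key : ∀ t : ℝ, t * (-2 * wdot 1 z z) ≤ t ^ 2 * (wdot 1 z (A.mulVec z) - l * wdot 1 z z) := by
    intro t
    have h1 := hray (w + t • z)
    have h2 : wdot 1 z z = wdot 1 z (A.mulVec w) - l * wdot 1 z w := by
      conv_lhs => rw [hz, wdot_sub_right, wdot_smul_right, ← hz]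
    simp only [Matrix.mulVec_add, Matrix.mulVec_smul, wdot_add_left, wdot_add_right,
      wdot_smul_left, wdot_smul_right, hsym w z, wdot_comm 1 w z, hw, ← hl] at h1
    have h3 : t * wdot 1 z z = t * wdot 1 z (A.mulVec w) - t * (l * wdot 1 z w) := by
      rw [h2, mul_sub]
    linarith
  have h0 := eq_zero_of_forall_mul_le_sq_mul key
  exact sub_eq_zero.1 ((wdot_self_eq_zero hone).1 (by linarith))

variable (G : SimpleGraph V) [DecidableRel G.Adj]

lemma wdot_adjMatrix_comm (x y : V → ℝ) :
    wdot 1 x ((G.adjMatrix ℝ).mulVec y) = wdot 1 y ((G.adjMatrix ℝ).mulVec x) := by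
  have h : ∀ x y : V → ℝ, wdot 1 x y = dotProduct x y := fun x y => by simp [wdot, dotProduct]
  rw [h, h, Matrix.dotProduct_mulVec, ← Matrix.mulVec_transpose, SimpleGraph.transpose_adjMatrix,
    dotProduct_comm]

/-- For an edge `(i, k)`, the vector `e_i - e_k` has Rayleigh quotient `-1`. -/
lemma rayleigh_lower_bound_neg [DecidableEq V] {i k : V} (hik : G.Adj i k) {l : ℝ}
    (hl : ∀ x, l * wdot 1 x x ≤ wdot 1 x ((G.adjMatrix ℝ).mulVec x)) : l < 0 := by
  have h := hl (Pi.single i 1 - Pi.single k 1)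
  have hne := hik.ne
  have h1 : ∀ x y : V → ℝ, wdot 1 x y = dotProduct x y := fun x y => by simp [wdot, dotProduct]
  simp [h1, Matrix.mulVec_sub, sub_dotProduct, dotProduct_sub, hik, hik.symm, hne,
    hne.symm] at h
  linarith

lemma exists_competition_data [DecidableEq V] [Nontrivial V] (hG : G.Connected) {α γ : ℝ} (hα : 0 < α)
    (hγ : γ < 0) :
    ∃ l < 0, IsDominantEigenvalue (α • (1 : Matrix V V ℝ) + γ • G.adjMatrix ℝ) 1 (α + γ * l) := by
  obtain ⟨l, w, hw0, hw, hl⟩ := exists_min_rayleigh (wdot_adjMatrix_comm G)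
  obtain ⟨i⟩ := (inferInstance : Nonempty V)
  obtain ⟨k, hik⟩ := hG.preconnected.exists_adj_of_nontrivial i
  have hneg := rayleigh_lower_bound_neg G hik hl
  refine ⟨l, hneg, fun _ => one_pos, by nlinarith, fun x => ?_, w, hw0,
    (mulVec_affine_eq_iff hγ.ne).2 hw⟩
  rw [Matrix.add_mulVec, Matrix.smul_mulVec, Matrix.smul_mulVec, Matrix.one_mulVec,
    wdot_add_right, wdot_smul_right, wdot_smul_right]
  have := hl x
  nlinarith

lemma satField_neg {S : ℝ → ℝ} (hS : IsSaturating S) (d : ℝ) (M : Matrix V V ℝ) (u : ℝ)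
    (x : V → ℝ) : satField S d M u (-x) = -satField S d M u x := by
  funext i
  simp only [satField, Matrix.mulVec_neg, Pi.neg_apply, hS.odd]
  ring

variable [DecidableEq V]

/-- Under competition there are no nonzero nonnegative equilibria as long as `u α < d`. -/
lemma nonpos_of_equilibrium_of_nonneg {S : ℝ → ℝ} (hS : IsSaturating S) {d α γ u : ℝ}
    (hγ : γ ≤ 0) (hd : 0 < d) (hu : 0 < u) (hud : u * α < d) {x : V → ℝ} (hx : ∀ i, 0 ≤ x i)
    (heq : satField S d (α • (1 : Matrix V V ℝ) + γ • G.adjMatrix ℝ) u x = 0) (i : V) :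
    x i ≤ 0 := by
  by_contra! hi
  have h1 := satField_eq_zero_iff.1 heq i
  rw [Matrix.add_mulVec, Matrix.smul_mulVec, Matrix.smul_mulVec, Matrix.one_mulVec] at h1
  simp only [Pi.add_apply, Pi.smul_apply, smul_eq_mul] at h1
  have hA : 0 ≤ (G.adjMatrix ℝ).mulVec x i := by
    rw [SimpleGraph.adjMatrix_mulVec_apply]
    exact Finset.sum_nonneg fun j _ => hx j
  set y := α * x i + γ * (G.adjMatrix ℝ).mulVec x i with hy
  -- Competing neighbors only lower the argument, so `d x i = u S y < u α x i`, contrary to `u α <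
  -- d`.
  have hyle : y ≤ α * x i := by nlinarith
  have hSy : 0 < S y := pos_of_mul_pos_right (h1 ▸ mul_pos hd hi) hu.le
  have hSy' := (hS.lt_self (hS.pos_iff.1 hSy)).le.trans hyle
  nlinarith

/-- As `α < μ`, parameters near `d / μ` satisfy `u α < d`. A state without opposite signs is
nonnegative or, after the odd symmetry `x ↦ -x`, becomes so, and must then vanish. -/
lemma eventually_isDisagreement {S : ℝ → ℝ} (hS : IsSaturating S) {d α γ μ : ℝ} (hd : 0 < d)
    (hγ : γ ≤ 0) (hμ : 0 < μ) (hαμ : α < μ) :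
    ∀ᶠ p : ℝ × (V → ℝ) in 𝓝 (d / μ, 0),
      satField S d (α • (1 : Matrix V V ℝ) + γ • G.adjMatrix ℝ) p.1 p.2 = 0 → p.2 ≠ 0 →
      IsDisagreement p.2 := by
  have hpos : ∀ᶠ p : ℝ × (V → ℝ) in 𝓝 (d / μ, 0), 0 < p.1 :=
    continuousAt_fst.eventually (lt_mem_nhds (div_pos hd hμ))
  have hlt : ∀ᶠ p : ℝ × (V → ℝ) in 𝓝 (d / μ, 0), p.1 * α < d := by
    have : Continuous fun p : ℝ × (V → ℝ) => p.1 * α := by fun_prop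
    refine this.continuousAt.eventually (gt_mem_nhds ?_)
    simp only
    rw [div_mul_eq_mul_div, div_lt_iff₀ hμ]
    gcongr
  filter_upwards [hpos, hlt] with p hu hud heq hp0
  by_contra hcon
  apply hp0
  by_cases hex : ∃ i, 0 < p.2 i
  · obtain ⟨i, hi⟩ := hex
    have hx : ∀ k, 0 ≤ p.2 k := fun k => not_lt.1 fun hk => hcon ⟨i, k, hi, hk⟩
    exact absurd (nonpos_of_equilibrium_of_nonneg G hS hγ hd hu hud hx heq i) (not_le.2 hi)
  · push Not at hex
    have hneq := satField_neg hS d (α • (1 : Matrix V V ℝ) + γ • G.adjMatrix ℝ) p.1 p.2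
    rw [heq, neg_zero] at hneq
    funext i
    have := nonpos_of_equilibrium_of_nonneg G hS hγ hd hu hud (x := -p.2)
      (fun k => by simpa using hex k) hneq i
    simp only [Pi.neg_apply] at this
    exact le_antisymm (hex i) (by simpa using this)

end Competition

end

/-! ### The two cases of the theorem. -/

theorem theorem1 {V : Type*} [Fintype V] [DecidableEq V] [Nontrivial V]
    (S : ℝ → ℝ) (hS : IsSaturating S) (d α γ : ℝ) (hd : 0 < d) (hα : 0 < α) :
    (∀ G : Digraph V, (∀ i, ¬ G.Adj i i) → G.StronglyConnected → 0 < γ →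
      ∀ ua : ℝ, ua = d / (α + γ * lambdaMax G.adjacency) →
        0 < ua ∧
        (∀ u, 0 ≤ u → u < ua → IsLocallyExpStable (opinionField S d α γ G.adjacency u)) ∧
        (∀ u, ua < u → IsUnstable (opinionField S d α γ G.adjacency u)) ∧
        BifurcatesAlong (opinionField S d α γ G.adjacency) ua
          (genEigenspace G.adjacency (lambdaMax G.adjacency)) IsAgreement ∧
        HasBifurcationCurve (opinionField S d α γ G.adjacency) ua
          (genEigenspace G.adjacency (lambdaMax G.adjacency)) IsAgreement) ∧
    (∀ (G : SimpleGraph V) [DecidableRel G.Adj], G.Connected → γ < 0 →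
      ∀ ud : ℝ, ud = d / (α + γ * lambdaMin (G.adjMatrix ℝ)) →
        0 < ud ∧
        (∀ u, 0 ≤ u → u < ud → IsLocallyExpStable (opinionField S d α γ (G.adjMatrix ℝ) u)) ∧
        (∀ u, ud < u → IsUnstable (opinionField S d α γ (G.adjMatrix ℝ) u)) ∧
        BifurcatesAlong (opinionField S d α γ (G.adjMatrix ℝ)) ud
          (genEigenspace (G.adjMatrix ℝ) (lambdaMin (G.adjMatrix ℝ))) IsDisagreement ∧
        (Module.finrank ℝ (genEigenspace (G.adjMatrix ℝ) (lambdaMin (G.adjMatrix ℝ))) = 1 →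
          HasBifurcationCurve (opinionField S d α γ (G.adjMatrix ℝ)) ud
            (genEigenspace (G.adjMatrix ℝ) (lambdaMin (G.adjMatrix ℝ))) IsDisagreement)) := by
  constructor
  · rintro G - hG hγ ua rfl
    have hA : ∀ i j, 0 ≤ G.adjacency i j := fun i j => by
      rw [Digraph.adjacency, Matrix.of_apply]
      split_ifs <;> norm_num
    have hirr : ∀ i k, Relation.ReflTransGen (fun i j => 0 < G.adjacency i j) i k := fun i k =>
      Relation.ReflTransGen.mono (fun a b hab => by
        rw [Digraph.adjacency, Matrix.of_apply, if_pos hab]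
        exact one_pos) i k (hG i k)
    obtain ⟨r, q, w, h, hwpos, hw1, hw, hsimple⟩ := exists_perron_data hA hirr hα hγ
    rw [lambdaMax_eq_of_dominant hγ h, opinionField_eq_satField]
    have hW := genEigenspace_of_dominant hγ.ne' h
    have hP := eventually_isAgreement hS hd h hwpos hw1 hw hsimple
    have hcurve := h.hasBifurcationCurve hS hd hw1 hw hsimple hW hP
    have hua := div_pos hd h.pos
    refine ⟨hua, fun u hu hlt => h.isLocallyExpStable hS hu ((lt_div_iff₀ h.pos).1 hlt),
      fun u hlt => h.isUnstable hS (hua.trans hlt).le ((div_lt_iff₀ h.pos).1 hlt),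
      h.bifurcatesAlong hS hd hW hP fun _ hr => hcurve.eventually_exists hr, hcurve⟩
  · rintro G _ hG hγ ud rfl
    obtain ⟨l, hl, h⟩ := exists_competition_data G hG hα hγ
    rw [lambdaMin_eq_of_dominant hγ h, opinionField_eq_satField]
    have hW := genEigenspace_of_dominant hγ.ne h
    have hP := eventually_isDisagreement G hS (α := α) hd hγ.le h.pos (by nlinarith)
    have hud := div_pos hd h.pos
    have hsym : ∀ x y, wdot 1 x ((α • (1 : Matrix V V ℝ) + γ • G.adjMatrix ℝ).mulVec y) =
        wdot 1 y ((α • (1 : Matrix V V ℝ) + γ • G.adjMatrix ℝ).mulVec x) := fun x y => by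
      simp only [Matrix.add_mulVec, Matrix.smul_mulVec, Matrix.one_mulVec, wdot_add_right,
        wdot_smul_right, wdot_adjMatrix_comm G x y, wdot_comm 1 x y]
    refine ⟨hud, fun u hu hlt => h.isLocallyExpStable hS hu ((lt_div_iff₀ h.pos).1 hlt),
      fun u hlt => h.isUnstable hS (hud.trans hlt).le ((div_lt_iff₀ h.pos).1 hlt),
      -- The eigenvalue may be multiple here, so existence comes from the energy and not from a
      -- curve.
      h.bifurcatesAlong hS hd hW hP fun _ hr =>
        eventually_exists_equilibrium_of_symmetric hS h hd hsym hr, fun hrank => ?_⟩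
    obtain ⟨w, hw1, hw⟩ := exists_normalized_eigenvector h
    refine h.hasBifurcationCurve hS hd hw1 hw (fun x hx => ?_) hW hP
    have hw0 : w ≠ 0 := by
      rintro rfl
      simp [wdot] at hw1
    obtain ⟨c, hc⟩ := (finrank_eq_one_iff_of_nonzero' ⟨w, (hW w).2 hw⟩ (by
      simpa [Subtype.ext_iff] using hw0)).1 hrank ⟨x, (hW x).2 hx⟩
    exact ⟨c, congrArg Subtype.val hc⟩
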